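/- **Setting.** Let $\mathcal K$ be a finite simplicial complex with $n$ (non-empty) simplices and dimension $D$. Write $\sigma\prec\tau$ if $\sigma$ is a codimension-one face (a *facet*) of $\tau$. A *matching* on $\mathcal K$ is a set $M$ of pairs $(\sigma,\tau)$ with $\sigma\prec\tau$ such that every simplex is in at most one pair. It is a *Morse matching* if there is no cycle $a_1\prec b_1\succ a_2\prec b_2\succ\cdots\prec b_m\succ a_1$ with $m\ge 2$, $(a_i,b_i)\in M$ and the $b_i$ distinct. The Max Morse Matching Problem asks for a Morse matching that maximizes the number of matched simplices. For a matching $M$ let $\mathcal H_M$ be the directed graph on the simplices that has, for every $\sigma\prec\tau$, the *up-edge* $\sigma\to\tau$ if $(\sigma,\tau)\in M$ and the *down-edge* $\tau\to\sigma$ otherwise. In a directed graph $H$ of such edges, the *facet-edges* of $\beta$ are the edges of $H$, with their orientation in $H$, between $\beta$ and its facets. A *leading up-edge* of an up-edge $(\alpha_0,\beta_0)$ is an up-edge $(\alpha,\beta)$ of $H$ such that $H$ has the down-edge $\beta_0\to\alpha$. **Frontier Edges algorithm.** Compute a maximum-cardinality matching $M$ of the Hasse graph of $\mathcal K$, put $H:=\mathcal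 H_M$ and $G:=\emptyset$ (edge sets). While $H$ has an up-edge $\chi$: run BFSComponent$(H,\chi)$, which may reverse edges of $H$ and returns an edge set $C$; replace $H$ by $H\setminus C$ and $G$ by $G\cup C$. When $H$ has no up-edge left, return $G\cup H$. *BFSComponent*$(H,\chi)$: start with $C=\emptyset$ and a queue containing $\chi$. While the queue is not empty, dequeue $\chi_0=(\alpha_0,\beta_0)$, add the facet-edges of $\beta_0$ to $C$ and, for each leading up-edge $\chi_i=(\alpha_i,\beta_i)$ of $\chi_0$ that has not been classified yet (is not in $C$), in any order: if $C$ together with the facet-edges of $\beta_i$ has a directed cycle, reverse $\chi_i$ in $H$, otherwise enqueue $\chi_i$; in both cases add the facet-edges of $\beta_i$, with their present orientation, to $C$. Return $C$. **Theorem.** The Frontier Edges algorithm is a polynomial-time $\frac{D+1}{D^2+D+1}$-approximation algorithm for the Max Morse Matching Problem. That is: 1. For every choice of the maximum matching $M$, of the up-edges picked in the main loop and of the orders in which leading up-edges are examined, the algorithm never gets stuck and halts after at most $2n+1$ steps, where a step is one call of BFSComponent, one dequeuing, one examination of a leading up-edge, one end of the loop over the leading up-edges, one return from BFSComponent, or the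 final return. 2. Every returned graph is $\mathcal H_{\mathcal V}$ for a Morse matching $\mathcal V$ on $\mathcal K$, and for every Morse matching $\mathcal N$ on $\mathcal K$ the number of simplices matched by $\mathcal V$ is at least $\frac{D+1}{D^2+D+1}$ times the number of simplices matched by $\mathcal N$. 3. The algorithm, including the computation of $M$ and the tests for cycles, can be carried out in polynomial time: there are a polynomial $p$ and a program which, for every finite simplicial complex (given as a list of its simplices, each a list of its vertices), computes a possible output of the algorithm in at most $p(n)$ elementary steps. Here programs are list-processing programs over atoms (vertex names that can only be tested for equality), Booleans, pairs and lists, whose only loops are traversals of lists, and in which every primitive operation counts as one step. -/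

import Mathlib

namespace FrontierEdges

/-! ## Hasse graphs, matchings and Morse matchings

A simplicial complex is Mathlib's `PreAbstractSimplicialComplex V`: a down-closed family of
nonempty finite sets of vertices. The complexes of interest are those with finitely many faces. -/

/-- `σ` is a codimension-one face of `τ`; on the nonempty faces of a complex this is the covering
relation `σ ≺ τ` of the face poset. -/
def IsFacet {V : Type*} (σ τ : Finset V) : Prop :=
  σ ⊆ τ ∧ τ.card = σ.card + 1

/-- A directed edge between simplices, `(x, y)` pointing from `x` to `y`. A pair `(σ, τ)` of a
matching, with `σ` a facet of `τ`, is also written in this way. -/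
abbrev Edge (V : Type*) := Finset V × Finset V

/-- The dimension of a complex with finitely many faces (`0` for the complex without faces). -/
noncomputable def dimension {V : Type*} (K : PreAbstractSimplicialComplex V) : ℕ :=
  sSup {d : ℕ | ∃ σ ∈ K.faces, σ.card = d + 1}

/-- A partial matching on the face poset of `K`: a set of pairs `(σ, τ)` with `σ ≺ τ` such that
every face belongs to at most one pair. -/
def IsMatching {V : Type*} (K : PreAbstractSimplicialComplex V) (M : Set (Edge V)) : Prop :=
  (∀ p ∈ M, p.1 ∈ K.faces ∧ p.2 ∈ K.faces ∧ IsFacet p.1 p.2) ∧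
  ∀ p ∈ M, ∀ q ∈ M, ∀ σ : Finset V,
    (σ = p.1 ∨ σ = p.2) → (σ = q.1 ∨ σ = q.2) → p = q

/-- There is no cycle `a₀ ≺ b₀ ≻ a₁ ≺ b₁ ≻ ⋯ ≺ bₘ₋₁ ≻ a₀` with `m ≥ 2`, `(aᵢ, bᵢ) ∈ M` and
all the `bᵢ` distinct. Here `m = n + 2`, and `i + 1` is taken modulo `m`. -/
def IsAcyclicMatching {V : Type*} (M : Set (Edge V)) : Prop :=
  ¬ ∃ (n : ℕ) (a b : Fin (n + 2) → Finset V),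
    Function.Injective b ∧ ∀ i, (a i, b i) ∈ M ∧ IsFacet (a (i + 1)) (b i)

/-- A Morse matching on `K`: an acyclic partial matching on its face poset. -/
def IsMorseMatching {V : Type*} (K : PreAbstractSimplicialComplex V) (M : Set (Edge V)) : Prop :=
  IsMatching K M ∧ IsAcyclicMatching M

/-- The simplices matched by `M`. -/
def matchedSimplices {V : Type*} (M : Set (Edge V)) : Set (Finset V) :=
  {σ | ∃ p ∈ M, σ = p.1 ∨ σ = p.2}

/-- A maximum-cardinality matching in the Hasse graph of `K`. -/
def IsMaximumMatching {V : Type*} (K : PreAbstractSimplicialComplex V) (M : Set (Edge V)) : Prop :=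
  IsMatching K M ∧ ∀ N : Set (Edge V), IsMatching K N → N.ncard ≤ M.ncard

/-- `M` is a solution of the Max Morse Matching Problem on `K` within the factor `α`: it is a Morse
matching, and it matches at least `α` times as many simplices as any Morse matching does. -/
def IsApproxMaxMorseMatching {V : Type*} (K : PreAbstractSimplicialComplex V) (α : ℚ)
    (M : Set (Edge V)) : Prop :=
  IsMorseMatching K M ∧ ∀ N : Set (Edge V), IsMorseMatching K N →
    α * ((matchedSimplices N).ncard : ℚ) ≤ ((matchedSimplices M).ncard : ℚ)

/-- The edges of the Hasse graph of `K`, oriented by `M`: a pair in `M` points up, from `σ` to `τ`,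
and every other edge points down, from a simplex to its facet. -/
def orientedHasse {V : Type*} (K : PreAbstractSimplicialComplex V) (M : Set (Edge V)) :
    Set (Edge V) :=
  {e | (e.1 ∈ K.faces ∧ e.2 ∈ K.faces ∧ IsFacet e.1 e.2 ∧ e ∈ M) ∨
       (e.1 ∈ K.faces ∧ e.2 ∈ K.faces ∧ IsFacet e.2 e.1 ∧ e.swap ∉ M)}

/-! ## The Frontier Edges algorithm -/

/-- The up-edges of an oriented graph on simplices. -/
def upEdges {V : Type*} (H : Set (Edge V)) : Set (Edge V) :=
  {e | e ∈ H ∧ IsFacet e.1 e.2}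

/-- `χ` is a leading up-edge of the up-edge `χ₀` in `H`: `H` has the path consisting of `χ₀`, a
down-edge from the head of `χ₀` to the tail of `χ`, and `χ`. -/
def IsLeadingUpEdge {V : Type*} (H : Set (Edge V)) (χ₀ χ : Edge V) : Prop :=
  χ₀ ∈ upEdges H ∧ ((χ₀.2, χ.1) ∈ H ∧ IsFacet χ.1 χ₀.2) ∧ χ ∈ upEdges H

/-- The edges of `H`, with their orientation in `H`, between `β` and its facets. -/
def facetEdges {V : Type*} (H : Set (Edge V)) (β : Finset V) : Set (Edge V) :=
  {e | e ∈ H ∧ ((e.1 = β ∧ IsFacet e.2 β) ∨ (e.2 = β ∧ IsFacet e.1 β))}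

/-- The graph with edge set `C` has a directed cycle. -/
def HasCycle {V : Type*} (C : Set (Edge V)) : Prop :=
  ∃ x : Finset V, Relation.TransGen (fun y z => (y, z) ∈ C) x x

/-- `H` with the orientation of the edge `χ` reversed. -/
def reverseEdge {V : Type*} (H : Set (Edge V)) (χ : Edge V) : Set (Edge V) :=
  insert χ.swap (H \ {χ})

/-- The configurations of the algorithm. Throughout, `H` is the current edge set of the Hasse graph
oriented by the initial matching and `G` is the edge set of the output graph built so far.
* `main H G`: at the test of the `while` loop of the main procedure;
* `bfs H G C Q`: at the test of the `while` loop of `BFSComponent`, with component `C`, queue `Q`;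
* `scan H G C Q L`: in the `foreach` loop of `BFSComponent`, `L` being the up-edges still to be
  examined in it;
* `halted G`: the algorithm has returned `G`. -/
inductive State (V : Type*) where
  | main (H G : Set (Edge V))
  | bfs (H G C : Set (Edge V)) (Q : List (Edge V))
  | scan (H G C : Set (Edge V)) (Q L : List (Edge V))
  | halted (G : Set (Edge V))

/-- One step of the algorithm. The algorithm leaves open which up-edge the main loop picks and in
which order the leading up-edges are examined, so this is a relation. -/
inductive Step {V : Type*} : State V → State V → Prop
  /-- The main loop picks an up-edge `χ` of `H` and calls `BFSComponent`, which starts with an empty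
  component and with `χ` in the queue. -/
  | call (H G : Set (Edge V)) (χ : Edge V) (hχ : χ ∈ upEdges H) :
      Step (.main H G) (.bfs H G ∅ [χ])
  /-- `χ₀` is dequeued, the facet-edges of its head are added to `C`, and the `foreach` loop starts
  on the leading up-edges of `χ₀` that have not been classified before, listed in some order. -/
  | dequeue (H G C C' : Set (Edge V)) (χ₀ : Edge V) (Q L : List (Edge V))
      (hC' : C' = C ∪ facetEdges H χ₀.2) (hL : L.Nodup)
      (hmem : ∀ χ, χ ∈ L ↔ IsLeadingUpEdge H χ₀ χ ∧ χ ∉ C') :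
      Step (.bfs H G C (χ₀ :: Q)) (.scan H G C' Q L)
  /-- `χ` would close a cycle: it is classified as backward, that is, it is reversed in `H`, and the
  facet-edges of its head are added to `C`. -/
  | backward (H H' G C : Set (Edge V)) (χ : Edge V) (Q L : List (Edge V))
      (hcyc : HasCycle (C ∪ facetEdges H χ.2)) (hH' : H' = reverseEdge H χ) :
      Step (.scan H G C Q (χ :: L)) (.scan H' G (C ∪ facetEdges H' χ.2) Q L)
  /-- `χ` does not close a cycle: it is classified as forward, the facet-edges of its head are added
  to `C`, and it is enqueued. -/
  | forward (H G C : Set (Edge V)) (χ : Edge V) (Q L : List (Edge V))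
      (hcyc : ¬ HasCycle (C ∪ facetEdges H χ.2)) :
      Step (.scan H G C Q (χ :: L)) (.scan H G (C ∪ facetEdges H χ.2) (Q ++ [χ]) L)
  /-- The `foreach` loop ends. -/
  | endScan (H G C : Set (Edge V)) (Q : List (Edge V)) :
      Step (.scan H G C Q []) (.bfs H G C Q)
  /-- The queue is empty: `BFSComponent` returns `C`, whose edges are moved from `H` to `G`. -/
  | return (H G C : Set (Edge V)) :
      Step (.bfs H G C []) (.main (H \ C) (G ∪ C))
  /-- No up-edge is left in `H`: the remaining edges are added to `G`, which is returned. -/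
  | halt (H G : Set (Edge V)) (h : upEdges H = ∅) :
      Step (.main H G) (.halted (G ∪ H))

/-- `Run k s t`: the algorithm can get from `s` to `t` in exactly `k` steps. -/
inductive Run {V : Type*} : ℕ → State V → State V → Prop
  | refl (s : State V) : Run 0 s s
  | tail {k : ℕ} {s t u : State V} (h : Run k s t) (h' : Step t u) : Run (k + 1) s u

/-- The configuration after the initialisation with the maximum matching `M`. -/
def initial {V : Type*} (K : PreAbstractSimplicialComplex V) (M : Set (Edge V)) : State V :=
  .main (orientedHasse K M) ∅

/-- `G` is a possible output of the Frontier Edges algorithm on `K`. -/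
def IsOutput {V : Type*} (K : PreAbstractSimplicialComplex V) (G : Set (Edge V)) : Prop :=
  ∃ (M : Set (Edge V)) (k : ℕ), IsMaximumMatching K M ∧ Run k (initial K M) (.halted G)

/-! ## A programming language with a step count

A first-order language of list-processing programs. Its values are atoms (natural numbers that can
only be compared), Booleans, pairs and linked lists; the only loop is the traversal of a list, which
may be nested. Each primitive takes one unit of time, and is a constant number of operations on
pointers or atoms in the usual sense. The types bound the nesting of lists, so that a value built in
time `t` has size polynomial in `t`, even when written out without sharing. -/

/-- Types of values. -/
inductive Ty where
  | unit
  | bool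
  | atom
  | prod (a b : Ty)
  | list (a : Ty)

/-- The values of a type. -/
@[reducible] def Ty.Val : Ty → Type
  | .unit => Unit
  | .bool => Bool
  | .atom => ℕ
  | .prod a b => a.Val × b.Val
  | .list a => List a.Val

/-- `Prog a b` is the type of programs with input of type `a` and output of type `b`. -/
inductive Prog : Ty → Ty → Type where
  /-- return the input -/
  | id {a : Ty} : Prog a a
  /-- sequential composition: first `p`, then `q` -/
  | seq {a b c : Ty} (p : Prog a b) (q : Prog b c) : Prog a c
  /-- run both programs on the input and pair the results -/
  | pair {a b c : Ty} (p : Prog a b) (q : Prog a c) : Prog a (.prod b c)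
  | fst {a b : Ty} : Prog (.prod a b) a
  | snd {a b : Ty} : Prog (.prod a b) b
  | unit {a : Ty} : Prog a .unit
  | true {a : Ty} : Prog a .bool
  | false {a : Ty} : Prog a .bool
  /-- conditional -/
  | ite {a b : Ty} (c : Prog a .bool) (p q : Prog a b) : Prog a b
  /-- comparison of two atoms -/
  | eq : Prog (.prod .atom .atom) .bool
  | nil {a b : Ty} : Prog a (.list b)
  | cons {a : Ty} : Prog (.prod a (.list a)) (.list a)
  /-- case distinction on a list, with access to a context of type `c` -/
  | case {a b c : Ty} (p : Prog c b) (q : Prog (.prod c (.prod a (.list a))) b) :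
      Prog (.prod c (.list a)) b
  /-- traverse a list from left to right, updating a state of type `s` with the program `p`, which
  sees a context of type `c`, the current state and the current list element -/
  | fold {a s c : Ty} (p : Prog (.prod c (.prod s a)) s) :
      Prog (.prod c (.prod s (.list a))) s

/-- The result of a program on an input, together with the number of steps it takes. -/
def Prog.exec {a b : Ty} : Prog a b → a.Val → b.Val × ℕ
  | .id, x => (x, 1)
  | .seq p q, x => ((q.exec (p.exec x).1).1, (p.exec x).2 + (q.exec (p.exec x).1).2 + 1)
  | .pair p q, x => (((p.exec x).1, (q.exec x).1), (p.exec x).2 + (q.exec x).2 + 1)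
  | .fst, x => (x.1, 1)
  | .snd, x => (x.2, 1)
  | .unit, _ => ((), 1)
  | .true, _ => (Bool.true, 1)
  | .false, _ => (Bool.false, 1)
  | .ite c p q, x =>
      match (c.exec x).1 with
      | Bool.true => ((p.exec x).1, (c.exec x).2 + (p.exec x).2 + 1)
      | Bool.false => ((q.exec x).1, (c.exec x).2 + (q.exec x).2 + 1)
  | .eq, x => (decide (x.1 = x.2), 1)
  | .nil, _ => ([], 1)
  | .cons, x => (x.1 :: x.2, 1)
  | .case p q, x =>
      match x.2 with
      | [] => ((p.exec x.1).1, (p.exec x.1).2 + 1)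
      | y :: l => ((q.exec (x.1, (y, l))).1, (q.exec (x.1, (y, l))).2 + 1)
  | .fold p, x =>
      x.2.2.foldl
        (fun st y => ((p.exec (x.1, (st.1, y))).1, st.2 + (p.exec (x.1, (st.1, y))).2 + 1))
        (x.2.1, 1)

/-- Simplices are given to programs as lists of vertices, and complexes as lists of simplices. -/
abbrev simplexTy : Ty := .list .atom

/-- `L` lists the faces of `K`, each once, and each as a list of its distinct vertices. -/
def Lists (L : List (List ℕ)) (K : PreAbstractSimplicialComplex ℕ) : Prop :=
  (∀ l ∈ L, l.Nodup) ∧ (L.map List.toFinset).Nodup ∧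
    ∀ σ : Finset ℕ, σ ∈ K.faces ↔ ∃ l ∈ L, l.toFinset = σ

/-- The set of directed edges given by a list of pairs of simplices. -/
def edgesOf (E : List (List ℕ × List ℕ)) : Set (Edge ℕ) :=
  {e | ∃ p ∈ E, e = (p.1.toFinset, p.2.toFinset)}

end FrontierEdges

open FrontierEdges

/-!
**Executions.** All edge sets that occur in the algorithm have the form `headEdges K N B`: the edges
between the simplices in `B` and their facets, oriented by the set `N` of the up-edges of `M` that
have not been reversed. Within a component the simplices in `B` have the same dimension. An up-edge
that is classified is never classified again and costs at most four steps, hence at most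
`4 * M.ncard + 1 ≤ 2 * n + 1` steps altogether (`StateInv`).

**Acyclicity.** A component stays acyclic: a forward edge is tested, and the head of a reversed edge
has no incoming edge. When a component is returned, all up-edges that its forward edges lead to are
in it or in earlier components. Thus a cycle never leaves the component that was returned first among
those it meets, and so it is a cycle of one component (`ComponentInv.return`).

**Approximation.** Let a component have `f` forward edges, `b` backward edges, and let the complex
have dimension `D`. The head of a forward edge has at most `D` facets other than its tail. The tails
of all classified edges but the root are such facets, so `b + f - 1 ≤ f * D`. Moreover the tail of a
backward edge is a facet of the head of a forward edge other than the root, so `b ≤ (f - 1) * D`: if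
the cycle closed by a backward edge enters its tail from the head of the root, then either two
different simplices share two facets, or the component has had a cycle before
(`ComponentInv.exists_of_hasCycle`). The two bounds give `(D + 1) * b ≤ D ^ 2 * f`
(`count_arith`). Summing over the components, and comparing with the maximum matching `M`, which is at
least as large as any Morse matching, gives the factor.

**Polynomial time.** `PolyTime f` says that a program computes `f`, up to a choice of representations
(`Data`), in time polynomial in the length of the longest list in its input. This measure grows by at
most one with each primitive, so polynomial-time functions can be composed; a loop needs a bound on the
size of its state in addition (`PolyTime.foldl`). With these closure properties it suffices to write
the algorithm as a function on lists of simplices and edges.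

A maximum matching of the Hasse graph, which is bipartite by the parity of the dimension, is computed
by an auction (`auction`): an unmatched vertex on one side takes its cheapest neighbour away from the
present partner, and the price of that neighbour rises by one. At the end some price level is skipped,
and this level yields a vertex cover no larger than the matching (`AuctionInv.card_le`). Cycles are
detected by removing edges into sinks (`hasCycle_iff_peelAll`). The main loop is a function `next` on
configurations that performs at least one step of the algorithm as long as there is anything to do; by
the bound on the length of executions, iterating it `2 * n + 2` times completes the execution
(`isOutput_frontierEdges`).
-/

namespace FrontierEdges

/-! ### Polynomial-time functions of the programming language -/

/-- The length of the longest list that occurs in a value. Unlike the number of nodes of the value,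
it does not grow when a value is duplicated. -/
def Ty.size : (a : Ty) → a.Val → ℕ
  | .unit, _ => 0
  | .bool, _ => 0
  | .atom, _ => 0
  | .prod a b, x => max (a.size x.1) (b.size x.2)
  | .list a, l => max l.length (l.foldr (fun x m => max (a.size x) m) 0)

theorem Ty.size_list_le {a : Ty} {l : List a.Val} {m : ℕ} :
    (Ty.list a).size l ≤ m ↔ l.length ≤ m ∧ ∀ x ∈ l, a.size x ≤ m := by
  have h : l.foldr (fun x m => max (a.size x) m) 0 ≤ m ↔ ∀ x ∈ l, a.size x ≤ m := by
    induction l with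
    | nil => simp
    | cons y l ih => simp [ih]
  rw [Ty.size, max_le_iff, h]

/-- Every primitive lengthens a list by at most one element, so the running time bounds the
growth. -/
theorem Prog.size_exec_le {a b : Ty} (P : Prog a b) (x : a.Val) :
    b.size (P.exec x).1 ≤ a.size x + (P.exec x).2 := by
  induction P with
  | id => simp [exec]
  | seq p q ihp ihq =>
    have h1 := ihp x
    have h2 := ihq (p.exec x).1
    simp only [exec]
    omega
  | pair p q ihp ihq =>
    have h1 := ihp x
    have h2 := ihq x
    simp only [exec, Ty.size]
    omega
  | fst => simp only [exec, Ty.size]; omega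
  | snd => simp only [exec, Ty.size]; omega
  | unit => simp [exec, Ty.size]
  | true => simp [exec, Ty.size]
  | false => simp [exec, Ty.size]
  | ite c p q _ ihp ihq =>
    have h1 := ihp x
    have h2 := ihq x
    simp only [exec]
    split <;> simp only <;> omega
  | eq => simp [exec, Ty.size]
  | nil => simp [exec, Ty.size]
  | cons =>
    simp only [exec, Ty.size, List.length_cons, List.foldr_cons]
    omega
  | case p q ihp ihq =>
    obtain ⟨c, l⟩ := x
    cases l with
    | nil =>
      have h1 := ihp c
      simp only [exec, Ty.size]
      omega
    | cons y l =>
      have h1 := ihq (c, (y, l))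
      simp only [exec, Ty.size, List.length_cons, List.foldr_cons] at h1 ⊢
      omega
  | @fold a s c p ih =>
    obtain ⟨z, st, l⟩ := x
    simp only [exec]
    have key : ∀ (l : List a.Val) (N k : ℕ) (st : s.Val), c.size z ≤ N →
        (∀ y ∈ l, a.size y ≤ N) → s.size st ≤ N + k →
        s.size (l.foldl (fun st y => ((p.exec (z, (st.1, y))).1,
          st.2 + (p.exec (z, (st.1, y))).2 + 1)) (st, k)).1 ≤
        N + (l.foldl (fun st y => ((p.exec (z, (st.1, y))).1,
          st.2 + (p.exec (z, (st.1, y))).2 + 1)) (st, k)).2 := by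
      intro l
      induction l with
      | nil => intro N k st _ _ h; simpa using h
      | cons y l ihl =>
        intro N k st hz hl hst
        have h1 := ih (z, (st, y))
        have h2 := hl y (by simp)
        simp only [Ty.size] at h1
        exact ihl N _ _ hz (fun y' hy' => hl y' (by simp [hy'])) (by dsimp only; omega)
    have hl := (Ty.size_list_le (a := a) (l := l)).1 le_rfl
    refine key l _ 1 st ?_ (fun y hy => ?_) ?_
    · simp only [Ty.size]; omega
    · have := hl.2 y hy
      simp only [Ty.size] at this ⊢; omega
    · simp only [Ty.size]; omega

/-- Mathematical objects that values of the programming language can represent. An object may have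
several representations, as a finite set has by lists, but all of them have the same size. -/
class Data (α : Type) where
  /-- the type of the representing values -/
  ty : Ty
  /-- the value represents the object -/
  Rep : ty.Val → α → Prop
  /-- the size of the representing values -/
  size : α → ℕ
  size_eq : ∀ {v x}, Rep v x → ty.size v = size x
  exists_rep : ∀ x, ∃ v, Rep v x

section
open Data Polynomial

instance : Data Unit := ⟨.unit, fun _ _ => True, fun _ => 0, fun _ => rfl, fun _ => ⟨(), trivial⟩⟩
instance : Data Bool := ⟨.bool, fun v x => v = x, fun _ => 0, fun _ => rfl, fun x => ⟨x, rfl⟩⟩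
instance : Data ℕ := ⟨.atom, fun v x => v = x, fun _ => 0, fun _ => rfl, fun x => ⟨x, rfl⟩⟩

instance {α β : Type} [Data α] [Data β] : Data (α × β) where
  ty := .prod (ty α) (ty β)
  Rep v x := Rep v.1 x.1 ∧ Rep v.2 x.2
  size x := max (size x.1) (size x.2)
  size_eq h := by simp [Ty.size, size_eq h.1, size_eq h.2]
  exists_rep x := by
    obtain ⟨v, hv⟩ := exists_rep x.1
    obtain ⟨w, hw⟩ := exists_rep x.2
    exact ⟨(v, w), hv, hw⟩

instance {α : Type} [Data α] : Data (List α) where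
  ty := .list (ty α)
  Rep v x := List.Forall₂ Rep v x
  size l := max l.length (l.foldr (fun x m => max (size x) m) 0)
  size_eq {v x} h := by
    rw [Ty.size, h.length_eq]
    congr 1
    induction h with
    | nil => rfl
    | cons h _ ih => simp [ih, size_eq h]
  exists_rep l := by
    induction l with
    | nil => exact ⟨[], .nil⟩
    | cons x l ih =>
      obtain ⟨v, hv⟩ := exists_rep x
      obtain ⟨w, hw⟩ := ih
      exact ⟨v :: w, .cons hv hw⟩

theorem size_prod {α β : Type} [Data α] [Data β] (x : α × β) :
    size x = max (size x.1) (size x.2) := rfl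

theorem size_list_le {α : Type} [Data α] {l : List α} {m : ℕ} :
    size l ≤ m ↔ l.length ≤ m ∧ ∀ x ∈ l, size x ≤ m := by
  have h : l.foldr (fun x m => max (size x) m) 0 ≤ m ↔ ∀ x ∈ l, size x ≤ m := by
    induction l with
    | nil => simp
    | cons y l ih => simp [ih]
  rw [← h, ← max_le_iff]; rfl

theorem size_le_of_mem {α : Type} [Data α] {l : List α} {x : α} (h : x ∈ l) : size x ≤ size l :=
  (size_list_le.1 le_rfl).2 x h

theorem length_le_size {α : Type} [Data α] (l : List α) : l.length ≤ size l :=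
  (size_list_le.1 le_rfl).1

theorem size_le_of_subset {α : Type} [Data α] {l l' : List α} (h : l ⊆ l')
    (h' : l.length ≤ l'.length) : size l ≤ size l' :=
  size_list_le.2 ⟨h'.trans (length_le_size l'), fun _ hx => size_le_of_mem (h hx)⟩

theorem size_filter_le {α : Type} [Data α] (l : List α) (p : α → Bool) :
    size (l.filter p) ≤ size l :=
  size_le_of_subset (List.filter_subset_self ..) (List.length_filter_le ..)

theorem size_cons {α : Type} [Data α] (x : α) (l : List α) :
    size (x :: l) ≤ max (size x) (size l + 1) := by
  have := length_le_size l
  refine size_list_le.2 ⟨by simp; omega, fun y hy => ?_⟩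
  rcases List.mem_cons.1 hy with rfl | hy
  · omega
  · have := size_le_of_mem hy; omega

theorem eval_le_eval (p : ℕ[X]) {m n : ℕ} (h : m ≤ n) : p.eval m ≤ p.eval n := by
  induction p using Polynomial.induction_on' with
  | add p q hp hq => simpa using Nat.add_le_add hp hq
  | monomial k c => simpa using Nat.mul_le_mul_left c (Nat.pow_le_pow_left h k)

/-- Case distinction on a list. -/
def listCase {α β : Type} (l : List α) (b : β) (f : α → List α → β) : β :=
  match l with
  | [] => b
  | x :: l => f x l

@[simp] theorem listCase_nil {α β : Type} (b : β) (f : α → List α → β) : listCase [] b f = b := rfl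

@[simp] theorem listCase_cons {α β : Type} (x : α) (l : List α) (b : β) (f : α → List α → β) :
    listCase (x :: l) b f = f x l := rfl

theorem foldl_cons_map {α β : Type} (f : α → β) (l : List α) (s : List β) :
    l.foldl (fun s b => f b :: s) s = (l.map f).reverse ++ s := by
  induction l generalizing s with
  | nil => rfl
  | cons a l ih => simp [ih]

/-- Some program computes `f` in time polynomial in the size of the input. -/
@[fun_prop] def PolyTime {α β : Type} [Data α] [Data β] (f : α → β) : Prop :=
  ∃ (P : Prog (ty α) (ty β)) (p : ℕ[X]), ∀ v x, Rep v x →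
    Rep (P.exec v).1 (f x) ∧ (P.exec v).2 ≤ p.eval (size x)

section
variable {α β γ σ : Type} [Data α] [Data β] [Data γ] [Data σ]

theorem PolyTime.exists_size_le {f : α → β} (hf : PolyTime f) :
    ∃ p : ℕ[X], ∀ x, size (f x) ≤ p.eval (size x) := by
  obtain ⟨P, p, h⟩ := hf
  refine ⟨X + p, fun x => ?_⟩
  obtain ⟨v, hv⟩ := exists_rep x
  obtain ⟨h1, h2⟩ := h v x hv
  have := P.size_exec_le v
  rw [size_eq h1, size_eq hv] at this
  simp only [eval_add, eval_X]
  omega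

/-- A program with bounded running time computes `f`. -/
theorem PolyTime.of_const {f : α → β} (P : Prog (ty α) (ty β)) (k : ℕ)
    (h : ∀ v x, Rep v x → Rep (P.exec v).1 (f x) ∧ (P.exec v).2 ≤ k) : PolyTime f :=
  ⟨P, C k, fun v x hv => by simpa using h v x hv⟩

@[fun_prop] theorem PolyTime.id : PolyTime (fun x : α => x) :=
  .of_const .id 1 fun _ _ h => ⟨h, le_rfl⟩

@[fun_prop] theorem PolyTime.comp {g : β → γ} {f : α → β} (hg : PolyTime g) (hf : PolyTime f) :
    PolyTime (fun x => g (f x)) := by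
  obtain ⟨r, hr⟩ := hf.exists_size_le
  obtain ⟨P, p, hp⟩ := hf
  obtain ⟨Q, q, hq⟩ := hg
  refine ⟨P.seq Q, p + q.comp r + 1, fun v x hv => ?_⟩
  obtain ⟨h1, h2⟩ := hp v x hv
  obtain ⟨h3, h4⟩ := hq _ _ h1
  have h5 := eval_le_eval q (hr x)
  refine ⟨h3, ?_⟩
  simp only [Prog.exec, eval_add, eval_comp, eval_one]
  omega

@[fun_prop] theorem PolyTime.prodMk {f : α → β} {g : α → γ} (hf : PolyTime f) (hg : PolyTime g) :
    PolyTime (fun x => (f x, g x)) := by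
  obtain ⟨P, p, hp⟩ := hf
  obtain ⟨Q, q, hq⟩ := hg
  refine ⟨P.pair Q, p + q + 1, fun v x hv => ?_⟩
  obtain ⟨h1, h2⟩ := hp v x hv
  obtain ⟨h3, h4⟩ := hq v x hv
  refine ⟨⟨h1, h3⟩, ?_⟩
  simp only [Prog.exec, eval_add, eval_one]
  omega

@[fun_prop] theorem PolyTime.fst {f : α → β × γ} (hf : PolyTime f) : PolyTime (fun x => (f x).1) :=
  comp (g := Prod.fst) (.of_const .fst 1 fun _ _ h => ⟨h.1, le_rfl⟩) hf

@[fun_prop] theorem PolyTime.snd {f : α → β × γ} (hf : PolyTime f) : PolyTime (fun x => (f x).2) :=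
  comp (g := Prod.snd) (.of_const .snd 1 fun _ _ h => ⟨h.2, le_rfl⟩) hf

@[fun_prop] theorem PolyTime.unit : PolyTime (fun _ : α => ()) :=
  .of_const .unit 1 fun _ _ _ => ⟨trivial, le_rfl⟩

@[fun_prop] theorem PolyTime.true : PolyTime (fun _ : α => true) :=
  .of_const .true 1 fun _ _ _ => ⟨rfl, le_rfl⟩

@[fun_prop] theorem PolyTime.false : PolyTime (fun _ : α => false) :=
  .of_const .false 1 fun _ _ _ => ⟨rfl, le_rfl⟩

@[fun_prop] theorem PolyTime.nil : PolyTime (fun _ : α => ([] : List β)) :=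
  .of_const .nil 1 fun _ _ _ => ⟨.nil, le_rfl⟩

@[fun_prop] theorem PolyTime.cons {f : α → β} {g : α → List β} (hf : PolyTime f)
    (hg : PolyTime g) : PolyTime (fun x => f x :: g x) :=
  comp (g := fun z : β × List β => z.1 :: z.2)
    (.of_const .cons 1 fun _ _ h => ⟨.cons h.1 h.2, le_rfl⟩) (prodMk hf hg)

theorem PolyTime.cond {c : α → Bool} {f g : α → β} (hc : PolyTime c) (hf : PolyTime f)
    (hg : PolyTime g) : PolyTime (fun x => bif c x then f x else g x) := by
  obtain ⟨R, r, hr⟩ := hc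
  obtain ⟨P, p, hp⟩ := hf
  obtain ⟨Q, q, hq⟩ := hg
  refine ⟨.ite R P Q, r + p + q + 1, fun v x hv => ?_⟩
  obtain ⟨h1, h2⟩ := hp v x hv
  obtain ⟨h3, h4⟩ := hq v x hv
  obtain ⟨h5, h6⟩ := hr v x hv
  replace h5 : (R.exec v).1 = c x := h5
  simp only [Prog.exec, eval_add, eval_one]
  cases hcx : c x <;> rw [hcx] at h5 <;> simp only [h5, cond_true, cond_false]
  · exact ⟨h3, by omega⟩
  · exact ⟨h1, by omega⟩

@[fun_prop] theorem PolyTime.listCase {l : γ → List α} {b : γ → β} {f : γ → α → List α → β}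
    (hl : PolyTime l) (hb : PolyTime b)
    (hf : PolyTime (fun z : γ × (α × List α) => f z.1 z.2.1 z.2.2)) :
    PolyTime (fun x => listCase (l x) (b x) (f x)) := by
  refine comp (g := fun z : γ × List α => FrontierEdges.listCase z.2 (b z.1) (f z.1)) ?_
    (prodMk id hl)
  obtain ⟨P, p, hp⟩ := hb
  obtain ⟨Q, q, hq⟩ := hf
  refine ⟨.case P Q, p + q + 1, fun v x hv => ?_⟩
  obtain ⟨v, w⟩ := v
  obtain ⟨x, m⟩ := x
  obtain ⟨hv, hw⟩ := hv
  simp only [eval_add, eval_one, size_prod]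
  dsimp only at hv
  cases hw with
  | nil =>
    obtain ⟨h1, h2⟩ := hp v x hv
    have := eval_le_eval p (le_max_left (size x) (size ([] : List α)))
    exact ⟨h1, by simp only [Prog.exec]; omega⟩
  | @cons y a w m hy hm =>
    obtain ⟨h1, h2⟩ := hq (v, (y, w)) (x, (a, m)) ⟨hv, hy, hm⟩
    refine ⟨h1, ?_⟩
    have h3 : size (x, (a, m)) ≤ max (size x) (size (a :: m)) := by
      have h4 : size a ≤ size (a :: m) := size_le_of_mem (by simp)
      have h5 : size m ≤ size (a :: m) := size_le_of_subset (by simp) (by simp)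
      simp only [size_prod]
      omega
    have := eval_le_eval q h3
    simp only [Prog.exec]; omega

/-- A loop runs in polynomial time if its body does and the states remain of polynomial size. The
second condition is indispensable: a body that doubles the state takes polynomial time. -/
theorem PolyTime.foldl {c : α → γ} {s : α → σ} {l : α → List β} {f : γ → σ → β → σ}
    (hf : PolyTime (fun z : γ × (σ × β) => f z.1 z.2.1 z.2.2))
    (h : ∃ q : ℕ[X], ∀ (m : ℕ) (c : γ) (s : σ) (l : List β), size c ≤ m → size s ≤ m → size l ≤ m →
      size (l.foldl (f c) s) ≤ q.eval m)
    (hc : PolyTime c) (hs : PolyTime s) (hl : PolyTime l) :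
    PolyTime (fun x => (l x).foldl (f (c x)) (s x)) := by
  refine comp (g := fun z : γ × (σ × List β) => z.2.2.foldl (f z.1) z.2.1) ?_
    (prodMk hc (prodMk hs hl))
  obtain ⟨q, hq⟩ := h
  obtain ⟨P, p, hp⟩ := hf
  refine ⟨.fold P, 1 + X * (p.comp (X + q) + 1), fun v x hv => ?_⟩
  obtain ⟨v, u, w⟩ := v
  obtain ⟨c, s, l⟩ := x
  obtain ⟨hv, hu, hw⟩ := hv
  dsimp only at hv hu hw
  set m := size (c, (s, l)) with hm
  have hcm : size c ≤ m := le_max_left ..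
  have hsm : size s ≤ m := (le_max_left ..).trans (le_max_right ..)
  have hlm : size l ≤ m := (le_max_right ..).trans (le_max_right ..)
  have key : ∀ (w : List (ty β).Val) (l l' : List β) (u : (ty σ).Val) (k : ℕ),
      List.Forall₂ Rep w l → size (l' ++ l) ≤ m → Rep u (l'.foldl (f c) s) →
      Rep (w.foldl (fun st y => ((P.exec (v, (st.1, y))).1,
          st.2 + (P.exec (v, (st.1, y))).2 + 1)) (u, k)).1 ((l' ++ l).foldl (f c) s) ∧
      (w.foldl (fun st y => ((P.exec (v, (st.1, y))).1,
          st.2 + (P.exec (v, (st.1, y))).2 + 1)) (u, k)).2 ≤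
        k + l.length * (p.eval (m + q.eval m) + 1) := by
    intro w l l' u k hw
    induction hw generalizing l' u k with
    | nil => intro _ h; simpa using h
    | @cons y b w l hy hw ih =>
      intro hl' hu
      have hmem : size b ≤ m := (size_le_of_mem (by simp)).trans hl'
      have h0 : size l' ≤ m := (size_le_of_subset (by simp) (by simp)).trans hl'
      have h1 := hq m c s l' hcm hsm h0
      obtain ⟨h2, h3⟩ := hp (v, (u, y)) (c, (l'.foldl (f c) s, b)) ⟨hv, hu, hy⟩
      have h4 : size (c, (l'.foldl (f c) s, b)) ≤ m + q.eval m := by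
        simp only [size_prod]; omega
      have h5 := h3.trans (eval_le_eval p h4)
      have := ih (l' ++ [b]) ((P.exec (v, (u, y))).1) (k + (P.exec (v, (u, y))).2 + 1)
        (by simpa using hl') (by simpa using h2)
      rw [List.append_assoc, List.singleton_append] at this
      refine ⟨this.1, this.2.trans ?_⟩
      rw [List.length_cons, Nat.succ_mul]
      omega
  obtain ⟨h1, h2⟩ := key w l [] u 1 hw hlm hu
  refine ⟨h1, h2.trans ?_⟩
  simp only [eval_add, eval_one, eval_mul, eval_X, eval_comp]
  gcongr
  exact (length_le_size l).trans hlm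

/-! ### List operations in polynomial time -/

/-- A loop that lengthens the state by at most one element at a time. -/
theorem PolyTime.foldl_of_size_le {c : α → γ} {s : α → σ} {l : α → List β} {f : γ → σ → β → σ}
    (hf : PolyTime (fun z : γ × (σ × β) => f z.1 z.2.1 z.2.2)) (q : ℕ[X])
    (h : ∀ c s b, size (f c s b) ≤ max (q.eval (max (size c) (size b))) (size s + 1))
    (hc : PolyTime c) (hs : PolyTime s) (hl : PolyTime l) :
    PolyTime (fun x => (l x).foldl (f (c x)) (s x)) := by
  refine foldl hf ⟨q + X + X, fun m c s l hc hs hl => ?_⟩ hc hs hl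
  have key : ∀ l : List β, size l ≤ m → size (l.foldl (f c) s) ≤ q.eval m + m + l.length := by
    intro l
    induction l using List.reverseRecOn with
    | nil => intro _; simp; omega
    | append_singleton l b ih =>
      intro hl
      have h1 : size b ≤ m := (size_le_of_mem (by simp)).trans hl
      have h2 := ih ((size_le_of_subset (by simp) (by simp)).trans hl)
      have h3 := h c (l.foldl (f c) s) b
      have h4 := eval_le_eval q (max_le hc h1)
      rw [List.foldl_append, List.length_append, List.foldl_cons, List.foldl_nil,
        List.length_singleton]
      omega
  have := key l hl
  have := length_le_size l
  simp only [eval_add, eval_X]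
  omega

@[fun_prop] theorem PolyTime.reverse {f : α → List β} (hf : PolyTime f) :
    PolyTime (fun x => (f x).reverse) := by
  have : PolyTime (fun x : α => (f x).foldl (fun s b => b :: s) []) := by
    refine foldl_of_size_le (c := fun _ => ()) (f := fun _ s b => b :: s) (by fun_prop) X
      (fun c s b => ?_) unit nil hf
    have := size_cons b s
    simp only [eval_X]; omega
  simpa using this

@[fun_prop] theorem PolyTime.append {f g : α → List β} (hf : PolyTime f) (hg : PolyTime g) :
    PolyTime (fun x => f x ++ g x) := by
  have : PolyTime (fun x : α => (f x).reverse.foldl (fun s b => b :: s) (g x)) := by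
    refine foldl_of_size_le (c := fun _ => ()) (f := fun _ s b => b :: s) (by fun_prop) X
      (fun c s b => ?_) unit hg (by fun_prop)
    have := size_cons b s
    simp only [eval_X]; omega
  simpa [List.foldl_reverse] using this

@[fun_prop] theorem PolyTime.map {f : α → List β} {g : α → β → γ} (hf : PolyTime f)
    (hg : PolyTime (fun z : α × β => g z.1 z.2)) : PolyTime (fun x => (f x).map (g x)) := by
  obtain ⟨q, hq⟩ := hg.exists_size_le
  have : PolyTime (fun x : α => ((f x).foldl (fun s b => g x b :: s) []).reverse) := by
    refine reverse (foldl_of_size_le (c := fun x => x) (f := fun x s b => g x b :: s) ?_ q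
      (fun x s b => ?_) id nil hf)
    · exact cons (comp hg (f := fun z : α × (List γ × β) => (z.1, z.2.2)) (by fun_prop))
        (by fun_prop)
    have h1 := size_cons (g x b) s
    have h2 := hq (x, b)
    simp only [size_prod] at h2
    omega
  simpa [foldl_cons_map] using this

end

/-! ### Decidable predicates in polynomial time -/

/-- Some program decides `p` in polynomial time. -/
@[fun_prop] def PolyPred {α : Type} [Data α] (p : α → Prop) : Prop :=
  ∃ f : α → Bool, PolyTime f ∧ ∀ x, f x = true ↔ p x

section
variable {α β γ σ : Type} [Data α] [Data β] [Data γ] [Data σ]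

theorem PolyPred.comp {p : β → Prop} {f : α → β} (hp : PolyPred p) (hf : PolyTime f) :
    PolyPred (fun x => p (f x)) := by
  obtain ⟨P, hP, h⟩ := hp
  exact ⟨fun x => P (f x), hP.comp hf, fun x => h (f x)⟩

@[fun_prop] theorem PolyPred.eq_true {f : α → Bool} (hf : PolyTime f) :
    PolyPred (fun x => f x = true) := ⟨f, hf, fun _ => Iff.rfl⟩

@[fun_prop] theorem PolyPred.not {p : α → Prop} (hp : PolyPred p) : PolyPred (fun x => ¬ p x) := by
  obtain ⟨P, hP, h⟩ := hp
  exact ⟨fun x => bif P x then false else true, hP.cond .false .true, fun x => by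
    simp only [← h]; cases P x <;> simp⟩

@[fun_prop] theorem PolyPred.and {p q : α → Prop} (hp : PolyPred p) (hq : PolyPred q) :
    PolyPred (fun x => p x ∧ q x) := by
  obtain ⟨P, hP, h⟩ := hp
  obtain ⟨Q, hQ, h'⟩ := hq
  exact ⟨fun x => bif P x then Q x else false, hP.cond hQ .false, fun x => by
    simp only [← h, ← h']; cases P x <;> simp⟩

@[fun_prop] theorem PolyPred.or {p q : α → Prop} (hp : PolyPred p) (hq : PolyPred q) :
    PolyPred (fun x => p x ∨ q x) := by
  obtain ⟨P, hP, h⟩ := hp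
  obtain ⟨Q, hQ, h'⟩ := hq
  exact ⟨fun x => bif P x then true else Q x, hP.cond .true hQ, fun x => by
    simp only [← h, ← h']; cases P x <;> simp⟩

@[fun_prop] theorem PolyTime.ite {p : α → Prop} [∀ x, Decidable (p x)] {f g : α → β}
    (hp : PolyPred p) (hf : PolyTime f) (hg : PolyTime g) :
    PolyTime (fun x => if p x then f x else g x) := by
  obtain ⟨P, hP, h⟩ := hp
  convert hP.cond hf hg using 2 with x
  by_cases hx : p x
  · simp [hx, (h x).2 hx]
  · have : P x = Bool.false := by simpa [hx] using h x
    simp [hx, this]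

@[fun_prop] theorem PolyTime.filter {f : α → List β} {p : α → β → Prop}
    [∀ x y, Decidable (p x y)] (hf : PolyTime f) (hp : PolyPred (fun z : α × β => p z.1 z.2)) :
    PolyTime (fun x => (f x).filter (fun y => p x y)) := by
  have : PolyTime (fun x : α =>
      ((f x).foldl (fun s b => if p x b then b :: s else s) []).reverse) := by
    refine reverse (foldl_of_size_le (c := fun x => x)
      (f := fun x s b => if p x b then b :: s else s) ?_ X (fun x s b => ?_) id nil hf)
    · exact ite (hp.comp (f := fun z : α × (List β × β) => (z.1, z.2.2)) (by fun_prop))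
        (by fun_prop) (by fun_prop)
    · have := size_cons b s
      simp only [eval_X]
      split <;> omega
  convert this using 2 with x
  have key : ∀ (l s : List β), l.foldl (fun s b => if p x b then b :: s else s) s =
      (l.filter (fun y => p x y)).reverse ++ s := by
    intro l
    induction l with
    | nil => simp
    | cons a l ih => intro s; by_cases h : p x a <;> simp [ih, h]
  simp [key]

@[fun_prop] theorem PolyPred.exists_mem {f : α → List β} {p : α → β → Prop} (hf : PolyTime f)
    (hp : PolyPred (fun z : α × β => p z.1 z.2)) : PolyPred (fun x => ∃ y ∈ f x, p x y) := by
  classical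
  refine ⟨fun x => listCase ((f x).filter (fun y => p x y)) false (fun _ _ => true), ?_,
    fun x => ?_⟩
  · exact .listCase (by fun_prop) .false .true
  · dsimp only
    cases h : (f x).filter (fun y => p x y) with
    | nil => simpa [List.filter_eq_nil_iff] using h
    | cons a l =>
      have : a ∈ (f x).filter (fun y => p x y) := by simp [h]
      rw [List.mem_filter] at this
      simp only [listCase_cons, true_iff]
      exact ⟨a, this.1, by simpa using this.2⟩

@[fun_prop] theorem PolyPred.forall_mem {f : α → List β} {p : α → β → Prop} (hf : PolyTime f)
    (hp : PolyPred (fun z : α × β => p z.1 z.2)) : PolyPred (fun x => ∀ y ∈ f x, p x y) := by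
  have : PolyPred (fun x => ¬ ∃ y ∈ f x, ¬ p x y) := by fun_prop
  simpa using this

/-- Comparison of lengths, by dropping an element of the left list for each element of the right
list. -/
@[fun_prop] theorem PolyPred.length_le {f : α → List β} {g : α → List γ} (hf : PolyTime f)
    (hg : PolyTime g) : PolyPred (fun x => (f x).length ≤ (g x).length) := by
  have h1 : PolyTime (fun x : α =>
      (g x).foldl (fun s _ => listCase s [] (fun _ t => t)) (f x)) := by
    refine .foldl_of_size_le (c := fun _ => ())
      (f := fun _ s _ => listCase s [] (fun _ t => t)) (by fun_prop) 0
      (fun c s b => ?_) .unit hf hg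
    have : size (listCase s [] (fun _ t => t)) ≤ size s := by
      cases s with
      | nil => exact le_rfl
      | cons a s => exact size_le_of_subset (by simp) (by simp)
    omega
  refine ⟨fun x => listCase ((g x).foldl (fun s _ => listCase s [] (fun _ t => t)) (f x)) true
    (fun _ _ => false), .listCase h1 .true .false, fun x => ?_⟩
  have key : ∀ (l : List γ) (s : List β),
      l.foldl (fun s _ => listCase s [] (fun _ t => t)) s = s.drop l.length := by
    intro l
    induction l with
    | nil => simp
    | cons a l ih => intro s; cases s <;> simp [ih]
  simp only [key, ← List.drop_eq_nil_iff]
  cases (f x).drop (g x).length <;> simp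

@[fun_prop] theorem PolyPred.eq_nil {f : α → List β} (hf : PolyTime f) :
    PolyPred (fun x => f x = []) := by
  have : PolyPred (fun x => (f x).length ≤ ([] : List Unit).length) := by fun_prop
  simpa using this

end

/-- Types of objects that can be tested for equality in polynomial time. -/
class DataEq (α : Type) [Data α] : Prop where
  eq : PolyPred (fun z : α × α => z.1 = z.2)

section
variable {α β γ σ : Type} [Data α] [Data β] [Data γ] [Data σ]

@[fun_prop] theorem PolyPred.eq [DataEq β] {f g : α → β} (hf : PolyTime f) (hg : PolyTime g) :
    PolyPred (fun x => f x = g x) :=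
  DataEq.eq.comp (hf.prodMk hg)

instance : DataEq ℕ :=
  ⟨fun z => decide (z.1 = z.2), .of_const .eq 1 fun v x h => ⟨by
    obtain ⟨h1, h2⟩ : v.1 = x.1 ∧ v.2 = x.2 := h
    simp only [Prog.exec, h1, h2]
    rfl, le_rfl⟩, by simp⟩

instance [DataEq α] [DataEq β] : DataEq (α × β) := ⟨by
  have : PolyPred (fun z : (α × β) × (α × β) => z.1.1 = z.2.1 ∧ z.1.2 = z.2.2) := by fun_prop
  simpa [Prod.ext_iff] using this⟩

@[fun_prop] theorem PolyPred.mem [DataEq β] {f : α → β} {g : α → List β} (hf : PolyTime f)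
    (hg : PolyTime g) : PolyPred (fun x => f x ∈ g x) := by
  have : PolyPred (fun x => ∃ y ∈ g x, f x = y) := by fun_prop
  simpa using this

/-! ### Simplices as data -/

/-- A finite set of vertices is represented by the lists of its distinct elements. -/
instance : Data (Finset ℕ) where
  ty := .list .atom
  Rep v x := v.Nodup ∧ v.toFinset = x
  size x := x.card
  size_eq {v x} h := by
    rw [← h.2, List.toFinset_card_of_nodup h.1, Ty.size]
    have (v : List ℕ) : v.foldr (fun x m => max (Ty.atom.size x) m) 0 = 0 := by
      induction v with
      | nil => rfl
      | cons a v ih => simp [Ty.size]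
    rw [this]
    simp
  exists_rep x := ⟨x.toList, x.nodup_toList, x.toList_toFinset⟩

theorem rep_toFinset {v : List ℕ} (hv : v.Nodup) : Rep (α := Finset ℕ) v v.toFinset := ⟨hv, rfl⟩

theorem rep_listNat (v : List ℕ) : Rep (α := List ℕ) v v :=
  List.forall₂_same.2 fun _ _ => rfl

theorem size_listNat {v : List ℕ} (hv : v.Nodup) : size v = size v.toFinset := by
  rw [← size_eq (rep_listNat v), ← size_eq (rep_toFinset hv)]; rfl

/-- A predicate on finite sets is decided in polynomial time if it is on their lists of elements. -/
theorem PolyPred.finset_pair {p : Finset ℕ × Finset ℕ → Prop} {q : List ℕ × List ℕ → Prop}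
    (hq : PolyPred q)
    (h : ∀ l l' : List ℕ, l.Nodup → l'.Nodup → (q (l, l') ↔ p (l.toFinset, l'.toFinset))) :
    PolyPred p := by
  obtain ⟨f, ⟨P, r, hP⟩, hf⟩ := hq
  refine ⟨fun z => f (z.1.toList, z.2.toList), ⟨P, r, ?_⟩, fun z => ?_⟩
  · rintro ⟨v, w⟩ ⟨x, y⟩ ⟨⟨hv, hx⟩, hw, hy⟩
    dsimp only at hv hw hx hy
    subst hx hy
    obtain ⟨h1, h2⟩ := hP (v, w) (v, w) ⟨rep_listNat v, rep_listNat w⟩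
    rw [size_prod, size_listNat hv, size_listNat hw] at h2
    refine ⟨?_, h2⟩
    have h3 : f (v, w) = f (v.toFinset.toList, w.toFinset.toList) := by
      rw [Bool.eq_iff_iff, hf, hf, h v w hv hw, h _ _ (Finset.nodup_toList _)
        (Finset.nodup_toList _)]
      simp
    simp only
    rw [← h3]
    exact h1
  · rw [hf, h _ _ (Finset.nodup_toList _) (Finset.nodup_toList _)]
    simp

instance : DataEq (Finset ℕ) := ⟨by
  have : PolyPred (fun z : List ℕ × List ℕ => (∀ x ∈ z.1, x ∈ z.2) ∧ ∀ x ∈ z.2, x ∈ z.1) := by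
    fun_prop
  refine this.finset_pair fun l l' _ _ => ?_
  simp only [Finset.ext_iff, List.mem_toFinset]
  exact ⟨fun h x => ⟨h.1 x, h.2 x⟩, fun h => ⟨fun x => (h x).1, fun x => (h x).2⟩⟩⟩

instance {V : Type*} [DecidableEq V] (σ τ : Finset V) : Decidable (IsFacet σ τ) :=
  inferInstanceAs (Decidable (_ ∧ _))

@[fun_prop] theorem PolyPred.isFacet {f g : α → Finset ℕ} (hf : PolyTime f) (hg : PolyTime g) :
    PolyPred (fun x => IsFacet (f x) (g x)) := by
  refine comp (p := fun z : Finset ℕ × Finset ℕ => IsFacet z.1 z.2) ?_ (hf.prodMk hg)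
  -- the equation of the cardinalities is expressed by two comparisons of lengths
  have : PolyPred (fun z : List ℕ × List ℕ => (∀ x ∈ z.1, x ∈ z.2) ∧
      z.2.length ≤ (() :: z.1.map (fun _ => ())).length ∧
      ¬ (z.2.length ≤ z.1.length)) := by fun_prop
  refine this.finset_pair fun l l' hl hl' => ?_
  simp only [IsFacet, List.toFinset_card_of_nodup hl, List.toFinset_card_of_nodup hl',
    Finset.subset_iff, List.mem_toFinset, List.length_cons, List.length_map]
  refine and_congr Iff.rfl ?_
  omega

/-- The cardinality of a finite set is even: the bipartition of the Hasse graph. -/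
@[fun_prop] theorem PolyPred.even_card {f : α → Finset ℕ} (hf : PolyTime f) :
    PolyPred (fun x => Even (f x).card) := by
  refine comp (p := fun z : Finset ℕ × Finset ℕ => Even z.1.card) ?_ (hf.prodMk hf)
  have : PolyPred (fun z : List ℕ × List ℕ =>
      z.1.foldl (fun s _ => if s = true then false else true) true = true) := by
    refine .eq_true (.foldl_of_size_le (c := fun _ => ())
      (f := fun _ (s : Bool) (_ : ℕ) => if s = true then false else true) (by fun_prop) 0
      (fun c s b => Nat.zero_le _) .unit .true (by fun_prop))
  refine this.finset_pair fun l l' hl _ => ?_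
  simp only [List.toFinset_card_of_nodup hl]
  clear hl
  induction l using List.reverseRecOn with
  | nil => simp
  | append_singleton l a ih =>
    rw [List.foldl_append, List.length_append, List.length_singleton, Nat.even_add_one, ← ih]
    simp

end

end

/-! ### Cycles through a given vertex -/

section
variable {α : Type*} {r r' : α → α → Prop} {b : α}
open Relation

/-- If all new edges of a graph are incident with `b`, then a path that is not an old one visits
`b`. -/
theorem transGen_or_through (h : ∀ x y, r' x y → r x y ∨ x = b ∨ y = b) {x y : α}
    (hxy : TransGen r' x y) :
    TransGen r x y ∨ (ReflTransGen r' x b ∧ ReflTransGen r' b y) := by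
  induction hxy with
  | single hy =>
    rcases h _ _ hy with h | rfl | rfl
    · exact .inl (.single h)
    · exact .inr ⟨.refl, .single hy⟩
    · exact .inr ⟨.single hy, .refl⟩
  | tail hxy hyz ih =>
    rcases ih with ih | ⟨ih1, ih2⟩
    · rcases h _ _ hyz with h | rfl | rfl
      · exact .inl (ih.tail h)
      · exact .inr ⟨hxy.to_reflTransGen, .single hyz⟩
      · exact .inr ⟨(hxy.tail hyz).to_reflTransGen, .refl⟩
    · exact .inr ⟨ih1, ih2.tail hyz⟩

theorem transGen_self_of_acyclic (h : ∀ x y, r' x y → r x y ∨ x = b ∨ y = b)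
    (hr : ∀ x, ¬ TransGen r x x) {x : α} (hx : TransGen r' x x) : TransGen r' b b := by
  rcases transGen_or_through h hx with hx' | ⟨h1, h2⟩
  · exact absurd hx' (hr x)
  · exact .trans_right h2 (.trans_left hx h1)

theorem transGen_of_ne {x y : α} (h : ReflTransGen r x y) (hne : x ≠ y) : TransGen r x y := by
  rcases reflTransGen_iff_eq_or_transGen.1 h with h | h
  · exact absurd h.symm hne
  · exact h

end

/-! ### The facet-edges of a set of simplices -/

section
variable {V : Type*} {K : PreAbstractSimplicialComplex V} {M N : Set (Edge V)}
  {A B X : Set (Finset V)} {χ χ' : Edge V} {β : Finset V}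

/-- The edges, in the Hasse graph oriented by `N`, between the simplices in `B` and their facets.
All edge sets that occur in the algorithm are of this form. -/
def headEdges (K : PreAbstractSimplicialComplex V) (N : Set (Edge V)) (B : Set (Finset V)) :
    Set (Edge V) :=
  {e | (e.1 ∈ K.faces ∧ e.2 ∈ K.faces ∧ IsFacet e.1 e.2 ∧ e ∈ N ∧ e.2 ∈ B) ∨
       (e.1 ∈ K.faces ∧ e.2 ∈ K.faces ∧ IsFacet e.2 e.1 ∧ e.swap ∉ N ∧ e.1 ∈ B)}

theorem IsFacet.not_swap {σ τ : Finset V} (h : IsFacet σ τ) : ¬ IsFacet τ σ := by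
  intro h'
  have := h.2
  have := h'.2
  omega

theorem IsFacet.ne {σ τ : Finset V} (h : IsFacet σ τ) : σ ≠ τ := by
  rintro rfl
  exact h.not_swap h

/-- Two different facets determine a simplex. -/
theorem IsFacet.eq_of_two_facets {σ σ' τ τ' : Finset V} (hne : σ ≠ σ') (h1 : IsFacet σ τ)
    (h2 : IsFacet σ' τ) (h3 : IsFacet σ τ') (h4 : IsFacet σ' τ') : τ = τ' := by
  classical
  have key : ∀ τ, IsFacet σ τ → IsFacet σ' τ → σ ∪ σ' = τ := by
    intro τ h h'
    refine Finset.eq_of_subset_of_card_le (Finset.union_subset h.1 h'.1) ?_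
    rw [h.2]
    refine Finset.card_lt_card (Finset.ssubset_iff_subset_ne.2 ⟨Finset.subset_union_left, ?_⟩)
    intro heq
    have h5 : σ' ⊆ σ := by rw [heq]; exact Finset.subset_union_right
    refine hne (Finset.eq_of_subset_of_card_le h5 ?_).symm
    have := h.2
    have := h'.2
    omega
  rw [← key τ h1 h2, key τ' h3 h4]

theorem headEdges_univ : headEdges K N Set.univ = orientedHasse K N := by
  ext e; simp [headEdges, orientedHasse]

theorem headEdges_empty : headEdges K N ∅ = ∅ := by
  ext e; simp [headEdges]

theorem headEdges_union : headEdges K N A ∪ headEdges K N B = headEdges K N (A ∪ B) := by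
  ext e
  simp only [headEdges, Set.mem_union, Set.mem_ofPred_eq]
  tauto

theorem headEdges_diff : headEdges K N A \ headEdges K N B = headEdges K N (A \ B) := by
  ext e
  have := IsFacet.not_swap (σ := e.1) (τ := e.2)
  simp only [headEdges, Set.mem_sdiff, Set.mem_ofPred_eq]
  tauto

theorem headEdges_mono (h : A ⊆ B) : headEdges K N A ⊆ headEdges K N B := by
  rw [← Set.union_eq_self_of_subset_left h, ← headEdges_union]
  exact Set.subset_union_left

theorem facetEdges_headEdges (h : β ∈ B) :
    facetEdges (headEdges K N B) β = headEdges K N {β} := by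
  ext e
  have := IsFacet.not_swap (σ := e.1) (τ := e.2)
  simp only [headEdges, facetEdges, Set.mem_ofPred_eq, Set.mem_singleton_iff]
  constructor
  · rintro ⟨h1, ⟨h2, h3⟩ | ⟨h2, h3⟩⟩ <;> subst h2 <;> tauto
  · rintro (⟨h1, h2, h3, h4, h5⟩ | ⟨h1, h2, h3, h4, h5⟩) <;> subst h5 <;> tauto

theorem headEdges_erase (hχ : IsFacet χ.1 χ.2) (h : χ.2 ∉ B) :
    headEdges K (N \ {χ}) B = headEdges K N B := by
  ext e
  simp only [headEdges, Set.mem_ofPred_eq, Set.mem_sdiff, Set.mem_singleton_iff]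
  refine or_congr ⟨by tauto, fun ⟨h1, h2, h3, h4, h5⟩ => ⟨h1, h2, h3, ⟨h4, ?_⟩, h5⟩⟩
    ⟨fun ⟨h1, h2, h3, h4, h5⟩ => ⟨h1, h2, h3, fun h6 => h4 ⟨h6, ?_⟩, h5⟩, by tauto⟩
  · rintro rfl; exact h h5
  · rintro rfl; exact h h5

theorem reverseEdge_headEdges (h1 : χ.1 ∈ K.faces) (h2 : χ.2 ∈ K.faces) (hχ : IsFacet χ.1 χ.2)
    (h : χ.2 ∈ B) : reverseEdge (headEdges K N B) χ = headEdges K (N \ {χ}) B := by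
  ext e
  have hs : e.swap = χ ↔ e = χ.swap := by
    constructor
    · rintro rfl; rfl
    · rintro rfl; rfl
  have hns := IsFacet.not_swap (σ := e.1) (τ := e.2)
  simp only [reverseEdge, headEdges, Set.mem_ofPred_eq, Set.mem_sdiff, Set.mem_singleton_iff,
    Set.mem_insert_iff, hs]
  by_cases he : e = χ.swap
  · subst he
    simp [h1, h2, hχ, h]
  · by_cases he' : e = χ
    · subst he'
      tauto
    · tauto

theorem IsMatching.eq_of_fst (hM : IsMatching K M) (h : χ ∈ M) (h' : χ' ∈ M) (he : χ.1 = χ'.1) :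
    χ = χ' :=
  hM.2 χ h χ' h' χ.1 (.inl rfl) (.inl he)

theorem IsMatching.eq_of_snd (hM : IsMatching K M) (h : χ ∈ M) (h' : χ' ∈ M) (he : χ.2 = χ'.2) :
    χ = χ' :=
  hM.2 χ h χ' h' χ.2 (.inr rfl) (.inr he)

theorem IsMatching.mono (hM : IsMatching K M) (h : N ⊆ M) : IsMatching K N :=
  ⟨fun p hp => hM.1 p (h hp), fun p hp q hq => hM.2 p (h hp) q (h hq)⟩

theorem upEdges_headEdges (hN : IsMatching K N) :
    upEdges (headEdges K N B) = {χ | χ ∈ N ∧ χ.2 ∈ B} := by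
  ext e
  have := IsFacet.not_swap (σ := e.1) (τ := e.2)
  have := hN.1 e
  simp only [upEdges, headEdges, Set.mem_ofPred_eq]
  tauto

theorem mem_headEdges_down (hM : IsMatching K M) (hN : N ⊆ M) (h : χ ∈ N) (h' : χ' ∈ N)
    (hne : χ ≠ χ') (hf : IsFacet χ'.1 χ.2) (hB : χ.2 ∈ B) : (χ.2, χ'.1) ∈ headEdges K N B := by
  refine .inr ⟨(hM.1 χ (hN h)).2.1, (hM.1 χ' (hN h')).1, hf, fun h1 => hne ?_, hB⟩
  have h2 := hM.eq_of_fst (hN h1) (hN h') rfl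
  have h3 := hM.eq_of_snd (hN h1) (hN h) rfl
  exact h3.symm.trans h2

theorem mem_headEdges_up (hM : IsMatching K M) (hN : N ⊆ M) (h : χ ∈ N) (hB : χ.2 ∈ B) :
    (χ.1, χ.2) ∈ headEdges K N B :=
  .inl ⟨(hM.1 χ (hN h)).1, (hM.1 χ (hN h)).2.1, (hM.1 χ (hN h)).2.2, h, hB⟩

theorem headEdges_into_head {c : ℕ} (hB : ∀ β ∈ B, β.card = c) {x y : Finset V}
    (h : (x, y) ∈ headEdges K N B) (hy : y.card = c) : (x, y) ∈ N ∧ y ∈ B := by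
  rcases h with ⟨_, _, _, h4, h5⟩ | ⟨_, _, h3, _, h5⟩
  · exact ⟨h4, h5⟩
  · have := hB _ h5
    have := h3.2
    simp only at *
    omega

theorem headEdges_into_tail {c : ℕ} (hB : ∀ β ∈ B, β.card = c) {x y : Finset V}
    (h : (x, y) ∈ headEdges K N B) (hy : y.card + 1 = c) :
    x ∈ B ∧ IsFacet y x ∧ (y, x) ∉ N := by
  rcases h with ⟨_, _, _, _, h5⟩ | ⟨_, _, h3, h4, h5⟩
  · have := hB _ h5
    simp only at *
    omega
  · exact ⟨h5, h3, h4⟩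

/-! ### The invariants of the algorithm -/

/-- There is a path consisting of the up-edges `χ`, `χ'` of `N` and a down-edge in between. -/
def Leads (N : Set (Edge V)) (χ χ' : Edge V) : Prop :=
  χ ∈ N ∧ χ' ∈ N ∧ χ ≠ χ' ∧ IsFacet χ'.1 χ.2

theorem Leads.mono {N' : Set (Edge V)} (h : Leads N χ χ') (hN : N ⊆ N') : Leads N' χ χ' :=
  ⟨hN h.1, hN h.2.1, h.2.2⟩

/-- `Leads` among the up-edges with heads in `X`. -/
def LeadsIn (N : Set (Edge V)) (X : Set (Finset V)) (χ χ' : Edge V) : Prop :=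
  Leads N χ χ' ∧ χ.2 ∈ X ∧ χ'.2 ∈ X

theorem isLeadingUpEdge_headEdges (hM : IsMatching K M) (hN : N ⊆ M) :
    IsLeadingUpEdge (headEdges K N B) χ χ' ↔ Leads N χ χ' ∧ χ.2 ∈ B ∧ χ'.2 ∈ B := by
  rw [IsLeadingUpEdge, upEdges_headEdges (hM.mono hN)]
  constructor
  · rintro ⟨⟨h1, h2⟩, ⟨h3, h4⟩, h5, h6⟩
    refine ⟨⟨h1, h5, ?_, h4⟩, h2, h6⟩
    rintro rfl
    rcases h3 with h3 | h3
    · exact h4.not_swap h3.2.2.1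
    · exact h3.2.2.2.1 h1
  · rintro ⟨⟨h1, h5, hne, h4⟩, h2, h6⟩
    exact ⟨⟨h1, h2⟩, ⟨mem_headEdges_down hM hN h1 h5 hne h4 h2, h4⟩, h5, h6⟩

/-- What holds of the set `X` of the heads of the up-edges that have been classified and moved to the
output graph: there are no cycles, no path leaves `X`, and the backward edges among them are few.
`N` is the set of the up-edges of `M` that have not been reversed. -/
structure DoneInv (K : PreAbstractSimplicialComplex V) (M N : Set (Edge V))
    (X : Set (Finset V)) : Prop where
  sub : N ⊆ M
  closed : ∀ χ χ', Leads N χ χ' → χ.2 ∈ X → χ'.2 ∈ X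
  acyclic : ∀ χ, ¬ Relation.TransGen (LeadsIn N X) χ χ
  count : (dimension K + 1) * {χ | χ ∈ M ∧ χ ∉ N ∧ χ.2 ∈ X}.ncard ≤
    dimension K ^ 2 * {χ | χ ∈ N ∧ χ.2 ∈ X}.ncard

/-- What holds of the set `B` of the heads of the up-edges classified in the component with root
`ρ`, while the edges in the queue `Q` and in the list `L` are still to be processed. -/
structure ComponentInv (K : PreAbstractSimplicialComplex V) (M N : Set (Edge V))
    (X B : Set (Finset V)) (ρ : Edge V) (Q L : List (Edge V)) : Prop extends DoneInv K M N X where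
  reversed : ∀ χ ∈ M, χ ∉ N → χ.2 ∈ X ∨ χ.2 ∈ B
  disjoint : ∀ β ∈ B, β ∉ X
  root_mem : ρ ∈ N
  root_head : ρ.2 ∈ B
  card : ∀ β ∈ B, β.card = ρ.2.card
  queue : ∀ χ ∈ Q, χ ∈ N ∧ χ.2 ∈ B
  list : ∀ χ ∈ L, χ ∈ N ∧ χ.2 ∉ X ∧ χ.2 ∉ B ∧ ∃ χ₀ ∈ N, χ₀.2 ∈ B ∧ χ₀ ≠ χ ∧ IsFacet χ.1 χ₀.2
  nodup : L.Nodup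
  leaving : ∀ χ χ', Leads N χ χ' → χ.2 ∈ B → χ ∉ Q → χ'.2 ∈ X ∨ χ'.2 ∈ B ∨ χ' ∈ L
  /-- an edge other than the root has been reached from a forward edge -/
  slot : ∀ χ ∈ M, χ.2 ∈ B → χ ≠ ρ → ∃ χ₀ ∈ N, χ₀.2 ∈ B ∧ χ₀ ≠ χ ∧ IsFacet χ.1 χ₀.2
  /-- a backward edge can be reached from a forward edge other than the root -/
  backward : ∀ χ ∈ M, χ ∉ N → χ.2 ∈ B → ∃ χ₀ ∈ N, χ₀.2 ∈ B ∧ χ₀ ≠ ρ ∧ IsFacet χ.1 χ₀.2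
  reach : ∀ χ ∈ N, χ.2 ∈ B →
    Relation.ReflTransGen (fun y z => (y, z) ∈ headEdges K N B) ρ.2 χ.2
  noCycle : ¬ HasCycle (headEdges K N B)

/-- A single up-edge is a component without cycles. -/
theorem not_hasCycle_singleton (hM : IsMatching K M) (hN : N ⊆ M) (hχ : χ ∈ N) :
    ¬ HasCycle (headEdges K N {χ.2}) := by
  rintro ⟨x, hx⟩
  have hcard : ∀ β ∈ ({χ.2} : Set (Finset V)), β.card = χ.2.card := by simp
  have h1 : Relation.TransGen (fun y z => (y, z) ∈ headEdges K N {χ.2}) χ.2 χ.2 := by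
    refine transGen_self_of_acyclic (r := fun _ _ => False) (fun y z h => ?_)
      (fun y h => ?_) hx
    · rcases h with h | h
      · exact .inr (.inr h.2.2.2.2)
      · exact .inr (.inl h.2.2.2.2)
    · obtain ⟨_, _, h⟩ := Relation.TransGen.tail'_iff.1 h
      exact h
  have hf := (hM.1 χ (hN hχ)).2.2
  obtain ⟨y, h2, h3⟩ := Relation.TransGen.tail'_iff.1 h1
  have h4 := headEdges_into_head hcard h3 rfl
  obtain rfl : y = χ.1 := congrArg Prod.fst (hM.eq_of_snd (hN h4.1) (hN hχ) rfl)
  obtain ⟨z, _, h6⟩ := Relation.TransGen.tail'_iff.1 (transGen_of_ne h2 hf.ne.symm)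
  obtain ⟨h7, _, h8⟩ := headEdges_into_tail hcard h6 hf.2.symm
  rw [Set.mem_singleton_iff.1 h7] at h8
  exact h8 hχ

variable {ρ χ₀ : Edge V} {Q L : List (Edge V)}

theorem mem_headEdges_insert {x y : Finset V} (h : (x, y) ∈ headEdges K N (insert β B)) :
    (x, y) ∈ headEdges K N B ∨ x = β ∨ y = β := by
  rcases h with ⟨h1, h2, h3, h4, rfl | h5⟩ | ⟨h1, h2, h3, h4, rfl | h5⟩
  · exact .inr (.inr rfl)
  · exact .inl (.inl ⟨h1, h2, h3, h4, h5⟩)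
  · exact .inr (.inl rfl)
  · exact .inl (.inr ⟨h1, h2, h3, h4, h5⟩)

theorem ComponentInv.card_insert (hM : IsMatching K M) (h : ComponentInv K M N X B ρ Q (χ :: L)) :
    ∀ β ∈ insert χ.2 B, β.card = ρ.2.card := by
  obtain ⟨h1, _, _, χ₀, h4, h5, _, h7⟩ := h.list χ (by simp)
  rintro β (rfl | hβ)
  · rw [← h.card _ h5, h7.2, (hM.1 χ (h.sub h1)).2.2.2]
  · exact h.card β hβ

/-- A cycle closed by a backward edge `χ` enters its tail from the head of a forward edge that is not
the root `ρ`: otherwise the heads of `χ` and `ρ` would share two facets, or the component would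
have a cycle already. -/
theorem ComponentInv.exists_of_hasCycle (hM : IsMatching K M)
    (h : ComponentInv K M N X B ρ Q (χ :: L)) (hcyc : HasCycle (headEdges K N (insert χ.2 B))) :
    ∃ χ₀ ∈ N, χ₀.2 ∈ B ∧ χ₀ ≠ ρ ∧ IsFacet χ.1 χ₀.2 := by
  obtain ⟨hχ, _, hχB, _⟩ := h.list χ (by simp)
  have hcard := h.card_insert hM
  have hf := (hM.1 χ (h.sub hχ)).2.2
  have hχc : χ.2.card = ρ.2.card := hcard _ (by simp)
  set R : Finset V → Finset V → Prop := fun y z => (y, z) ∈ headEdges K N (insert χ.2 B) with hR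
  obtain ⟨x, hx⟩ := hcyc
  have h1 : Relation.TransGen R χ.2 χ.2 :=
    transGen_self_of_acyclic (fun _ _ => mem_headEdges_insert) (fun y hy => h.noCycle ⟨y, hy⟩) hx
  -- the head of a backward edge has no incoming edges
  have hfw : ∀ z ∈ B, Relation.ReflTransGen R χ.2 z →
      ∃ χ₀ ∈ N, χ₀.2 = z ∧ Relation.ReflTransGen R χ.2 χ₀.1 := by
    intro z hz hzR
    obtain ⟨y, h2, h3⟩ := Relation.TransGen.tail'_iff.1
      (transGen_of_ne hzR (fun h => hχB (h ▸ hz)))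
    exact ⟨(y, z), (headEdges_into_head hcard h3 (h.card z hz)).1, rfl, h2⟩
  obtain ⟨y, h2, h3⟩ := Relation.TransGen.tail'_iff.1 h1
  have h4 := headEdges_into_head hcard h3 hχc
  obtain rfl : y = χ.1 := congrArg Prod.fst (hM.eq_of_snd (h.sub h4.1) (h.sub hχ) rfl)
  obtain ⟨z, h5, h6⟩ := Relation.TransGen.tail'_iff.1 (transGen_of_ne h2 hf.ne.symm)
  obtain ⟨h7, h8, h9⟩ := headEdges_into_tail hcard h6 (by rw [← hχc, hf.2])
  have hzB : z ∈ B := by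
    rcases h7 with rfl | h7
    · exact absurd hχ h9
    · exact h7
  obtain ⟨χ₀, h10, rfl, h11⟩ := hfw z hzB h5
  refine ⟨χ₀, h10, hzB, ?_, h8⟩
  rintro rfl
  have hf₀ := (hM.1 χ₀ (h.sub h10)).2.2
  have hne : χ.2 ≠ χ₀.1 := by
    intro h12
    have := hf₀.2
    rw [← h12, hχc] at this
    omega
  obtain ⟨w, h12, h13⟩ := Relation.TransGen.tail'_iff.1 (transGen_of_ne h11 hne)
  obtain ⟨h14, h15, h16⟩ := headEdges_into_tail hcard h13 hf₀.2.symm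
  rcases h14 with rfl | h14
  · have hne' : χ.1 ≠ χ₀.1 := by
      intro h17
      rw [hM.eq_of_fst (h.sub hχ) (h.sub h10) h17] at h9
      exact h9 h10
    exact hχB ((hf.eq_of_two_facets hne' h15 h8 hf₀) ▸ hzB)
  · obtain ⟨χ₁, h17, rfl, _⟩ := hfw w h14 h12
    refine h.noCycle ⟨χ₀.2, .tail' ((h.reach χ₁ h17 h14).tail ?_)
      (mem_headEdges_up hM h.sub h10 hzB)⟩
    exact .inr ⟨(hM.1 χ₁ (h.sub h17)).2.1, (hM.1 χ₀ (h.sub h10)).1, h15, h16, h14⟩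

/-! ### The invariants are preserved -/

theorem DoneInv.start : DoneInv K M M ∅ where
  sub := subset_rfl
  closed := by simp
  acyclic χ h := by
    obtain ⟨_, _, h⟩ := Relation.TransGen.tail'_iff.1 h
    exact h.2.2
  count := by simp

theorem DoneInv.call (hM : IsMatching K M) (h : DoneInv K M N X)
    (hrev : ∀ χ ∈ M, χ ∉ N → χ.2 ∈ X) (hχ : χ ∈ N) (hX : χ.2 ∉ X) :
    ComponentInv K M N X {χ.2} χ [χ] [] where
  toDoneInv := h
  reversed χ h1 h2 := .inl (hrev χ h1 h2)
  disjoint := by simpa using hX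
  root_mem := hχ
  root_head := rfl
  card := by simp
  queue := by simpa using hχ
  list := by simp
  nodup := by simp
  leaving χ' χ'' h1 h2 h3 := by
    refine absurd ?_ h3
    rw [hM.eq_of_snd (h.sub h1.1) (h.sub hχ) h2]
    simp
  slot χ' h1 h2 h3 := absurd (hM.eq_of_snd h1 (h.sub hχ) h2) h3
  backward χ' h1 h2 h3 := by
    rw [hM.eq_of_snd h1 (h.sub hχ) h3] at h2
    exact absurd hχ h2
  reach χ' _ h2 := by rw [h2]
  noCycle := not_hasCycle_singleton hM h.sub hχ

theorem ComponentInv.dequeue (h : ComponentInv K M N X B ρ (χ₀ :: Q) []) (hL : L.Nodup)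
    (hmem : ∀ χ, χ ∈ L ↔ Leads N χ₀ χ ∧ χ.2 ∉ X ∧ χ.2 ∉ B) :
    ComponentInv K M N X B ρ Q L where
  __ := h
  queue χ hχ := h.queue χ (by simp [hχ])
  list χ hχ := by
    obtain ⟨h1, h2⟩ := (hmem χ).1 hχ
    exact ⟨h1.2.1, h2.1, h2.2, χ₀, h1.1, (h.queue χ₀ (by simp)).2, h1.2.2⟩
  nodup := hL
  leaving χ χ' h1 h2 h3 := by
    by_cases hχ : χ = χ₀
    · subst hχ
      have := hmem χ'
      tauto
    · have := h.leaving χ χ' h1 h2 (by simp [h3, hχ])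
      simp only [List.not_mem_nil] at this
      tauto

theorem ComponentInv.forward (hM : IsMatching K M) (h : ComponentInv K M N X B ρ Q (χ :: L))
    (hcyc : ¬ HasCycle (headEdges K N (insert χ.2 B))) :
    ComponentInv K M N X (insert χ.2 B) ρ (Q ++ [χ]) L := by
  obtain ⟨hχ, hχX, hχB, χ₀, h1, h2, h3, h4⟩ := h.list χ (by simp)
  have hsub : headEdges K N B ⊆ headEdges K N (insert χ.2 B) := headEdges_mono (by simp)
  have hmono : ∀ {x y}, Relation.ReflTransGen (fun y z => (y, z) ∈ headEdges K N B) x y →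
      Relation.ReflTransGen (fun y z => (y, z) ∈ headEdges K N (insert χ.2 B)) x y :=
    Relation.ReflTransGen.mono (fun _ _ h => hsub h) _ _
  exact
  { toDoneInv := h.toDoneInv
    reversed := fun χ' h1 h2 => (h.reversed χ' h1 h2).imp_right .inr
    disjoint := by
      rintro β (rfl | hβ)
      exacts [hχX, h.disjoint β hβ]
    root_mem := h.root_mem
    root_head := .inr h.root_head
    card := h.card_insert hM
    queue := by
      intro χ' h5
      rcases List.mem_append.1 h5 with h5 | h5
      · exact ⟨(h.queue χ' h5).1, .inr (h.queue χ' h5).2⟩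
      · rw [List.mem_singleton.1 h5]
        exact ⟨hχ, .inl rfl⟩
    list := by
      intro χ' h5
      obtain ⟨h6, h7, h8, χ₁, h9, h10, h11⟩ := h.list χ' (by simp [h5])
      refine ⟨h6, h7, ?_, χ₁, h9, .inr h10, h11⟩
      rintro (h12 | h12)
      · rw [hM.eq_of_snd (h.sub h6) (h.sub hχ) h12] at h5
        exact (List.nodup_cons.1 h.nodup).1 h5
      · exact h8 h12
    nodup := (List.nodup_cons.1 h.nodup).2
    leaving := by
      rintro χ' χ'' h5 (h6 | h6) h7
      · refine absurd ?_ h7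
        simp [hM.eq_of_snd (h.sub h5.1) (h.sub hχ) h6]
      · rcases h.leaving χ' χ'' h5 h6 (fun h8 => h7 (by simp [h8])) with h8 | h8 | h8
        · exact .inl h8
        · exact .inr (.inl (.inr h8))
        · rcases List.mem_cons.1 h8 with rfl | h8
          · exact .inr (.inl (.inl rfl))
          · exact .inr (.inr h8)
    slot := by
      rintro χ' h5 (h6 | h6) h7
      · rw [hM.eq_of_snd h5 (h.sub hχ) h6]
        exact ⟨χ₀, h1, .inr h2, h3, h4⟩
      · obtain ⟨χ₁, h8, h9, h10⟩ := h.slot χ' h5 h6 h7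
        exact ⟨χ₁, h8, .inr h9, h10⟩
    backward := by
      rintro χ' h5 h6 (h7 | h7)
      · rw [hM.eq_of_snd h5 (h.sub hχ) h7] at h6
        exact absurd hχ h6
      · obtain ⟨χ₁, h8, h9, h10⟩ := h.backward χ' h5 h6 h7
        exact ⟨χ₁, h8, .inr h9, h10⟩
    reach := by
      rintro χ' h5 (h6 | h6)
      · rw [h6]
        exact ((hmono (h.reach χ₀ h1 h2)).tail
          (mem_headEdges_down hM h.sub h1 hχ h3 h4 (.inr h2))).tail
          (mem_headEdges_up hM h.sub hχ (.inl rfl))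
      · exact hmono (h.reach χ' h5 h6)
    noCycle := hcyc }

theorem DoneInv.erase (h : DoneInv K M N X) (hχX : χ.2 ∉ X) : DoneInv K M (N \ {χ}) X where
  sub := Set.sdiff_subset.trans h.sub
  closed χ' χ'' h1 := h.closed χ' χ'' (h1.mono Set.sdiff_subset)
  acyclic χ' h1 := h.acyclic χ' (Relation.TransGen.mono (fun _ _ h2 => ⟨h2.1.mono Set.sdiff_subset, h2.2⟩) _ _ h1)
  count := by
    have h1 : {χ' | χ' ∈ M ∧ χ' ∉ N \ {χ} ∧ χ'.2 ∈ X} = {χ' | χ' ∈ M ∧ χ' ∉ N ∧ χ'.2 ∈ X} := by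
      ext χ'
      by_cases h : χ' = χ
      · subst h; simp [hχX]
      · simp [h]
    have h2 : {χ' | χ' ∈ N \ {χ} ∧ χ'.2 ∈ X} = {χ' | χ' ∈ N ∧ χ'.2 ∈ X} := by
      ext χ'
      by_cases h : χ' = χ
      · subst h; simp [hχX]
      · simp [h]
    rw [h1, h2]
    exact h.count

theorem ComponentInv.reverse (hM : IsMatching K M) (h : ComponentInv K M N X B ρ Q (χ :: L))
    (hcyc : HasCycle (headEdges K N (insert χ.2 B))) :
    ComponentInv K M (N \ {χ}) X (insert χ.2 B) ρ Q L := by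
  obtain ⟨hχ, hχX, hχB, χ₀, h1, h2, h3, h4⟩ := h.list χ (by simp)
  have hf := (hM.1 χ (h.sub hχ)).2.2
  have hsub : headEdges K N B ⊆ headEdges K (N \ {χ}) (insert χ.2 B) := by
    rw [← headEdges_erase (N := N) hf hχB]
    exact headEdges_mono (by simp)
  have hmono : ∀ {x y}, Relation.ReflTransGen (fun y z => (y, z) ∈ headEdges K N B) x y →
      Relation.ReflTransGen (fun y z => (y, z) ∈ headEdges K (N \ {χ}) (insert χ.2 B)) x y :=
    Relation.ReflTransGen.mono (fun _ _ h => hsub h) _ _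
  have hkeep : ∀ χ' ∈ N, χ'.2 ∈ B → χ' ∈ N \ {χ} := by
    intro χ' h5 h6
    refine ⟨h5, ?_⟩
    rintro rfl
    exact hχB h6
  exact
  { toDoneInv := h.toDoneInv.erase hχX
    reversed := by
      intro χ' h5 h6
      by_cases h7 : χ' = χ
      · subst h7; exact .inr (.inl rfl)
      · exact (h.reversed χ' h5 (fun h8 => h6 ⟨h8, h7⟩)).imp_right .inr
    disjoint := by
      rintro β (rfl | hβ)
      exacts [hχX, h.disjoint β hβ]
    root_mem := hkeep _ h.root_mem h.root_head
    root_head := .inr h.root_head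
    card := h.card_insert hM
    queue := fun χ' h5 => ⟨hkeep χ' (h.queue χ' h5).1 (h.queue χ' h5).2, .inr (h.queue χ' h5).2⟩
    list := by
      intro χ' h5
      obtain ⟨h6, h7, h8, χ₁, h9, h10, h11⟩ := h.list χ' (by simp [h5])
      have hne : χ' ≠ χ := by
        rintro rfl
        exact (List.nodup_cons.1 h.nodup).1 h5
      refine ⟨⟨h6, hne⟩, h7, ?_, χ₁, hkeep χ₁ h9 h10, .inr h10, h11⟩
      rintro (h12 | h12)
      · exact hne (hM.eq_of_snd (h.sub h6) (h.sub hχ) h12)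
      · exact h8 h12
    nodup := (List.nodup_cons.1 h.nodup).2
    leaving := by
      rintro χ' χ'' h5 (h6 | h6) h7
      · exact absurd (hM.eq_of_snd (h.sub h5.1.1) (h.sub hχ) h6) h5.1.2
      · rcases h.leaving χ' χ'' (h5.mono Set.sdiff_subset) h6 h7 with h8 | h8 | h8
        · exact .inl h8
        · exact .inr (.inl (.inr h8))
        · rcases List.mem_cons.1 h8 with rfl | h8
          · exact .inr (.inl (.inl rfl))
          · exact .inr (.inr h8)
    slot := by
      rintro χ' h5 (h6 | h6) h7
      · rw [hM.eq_of_snd h5 (h.sub hχ) h6]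
        exact ⟨χ₀, hkeep χ₀ h1 h2, .inr h2, h3, h4⟩
      · obtain ⟨χ₁, h8, h9, h10⟩ := h.slot χ' h5 h6 h7
        exact ⟨χ₁, hkeep χ₁ h8 h9, .inr h9, h10⟩
    backward := by
      rintro χ' h5 h6 (h7 | h7)
      · rw [hM.eq_of_snd h5 (h.sub hχ) h7]
        obtain ⟨χ₁, h8, h9, h10⟩ := h.exists_of_hasCycle hM hcyc
        exact ⟨χ₁, hkeep χ₁ h8 h9, .inr h9, h10⟩
      · obtain ⟨χ₁, h8, h9, h10⟩ := h.backward χ' h5 (fun h8 => h6 ⟨h8, by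
          rintro rfl; exact hχB h7⟩) h7
        exact ⟨χ₁, hkeep χ₁ h8 h9, .inr h9, h10⟩
    reach := by
      rintro χ' h5 (h6 | h6)
      · exact absurd (hM.eq_of_snd (h.sub h5.1) (h.sub hχ) h6) h5.2
      · exact hmono (h.reach χ' h5.1 h6)
    noCycle := by
      -- the head of the reversed edge has no incoming edge
      rintro ⟨x, hx⟩
      have h5 : Relation.TransGen
          (fun y z => (y, z) ∈ headEdges K (N \ {χ}) (insert χ.2 B)) χ.2 χ.2 := by
        refine transGen_self_of_acyclic (fun y z hyz => ?_) (fun y hy => h.noCycle ⟨y, hy⟩) hx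
        rw [← headEdges_erase (N := N) hf hχB]
        exact mem_headEdges_insert hyz
      obtain ⟨y, _, h6⟩ := Relation.TransGen.tail'_iff.1 h5
      obtain ⟨h7, _⟩ := headEdges_into_head (h.card_insert hM) h6 (h.card_insert hM _ (by simp))
      exact h7.2 (hM.eq_of_snd (h.sub h7.1) (h.sub hχ) rfl) }

end

section
variable {V : Type*} {K : PreAbstractSimplicialComplex V} {M N : Set (Edge V)}
  {X B : Set (Finset V)} {χ χ₀ ρ : Edge V} {Q L : List (Edge V)}

/-! ### Counting backward edges -/

theorem IsMatching.finite (hK : K.faces.Finite) (hM : IsMatching K M) : M.Finite :=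
  (hK.prod hK).subset fun p hp => ⟨(hM.1 p hp).1, (hM.1 p hp).2.1⟩

theorem card_le_dimension (hK : K.faces.Finite) {σ : Finset V} (hσ : σ ∈ K.faces) :
    σ.card ≤ dimension K + 1 := by
  have hb : BddAbove {d : ℕ | ∃ σ ∈ K.faces, σ.card = d + 1} := by
    refine ((hK.image Finset.card).subset (t := {d : ℕ | ∃ σ ∈ K.faces, σ.card = d + 1}.image
      Nat.succ) ?_).of_finite_image (Nat.succ_injective.injOn) |>.bddAbove
    rintro _ ⟨d, ⟨σ, hσ, h⟩, rfl⟩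
    exact ⟨σ, hσ, h⟩
  have := le_csSup hb (a := σ.card - 1)
  by_cases h0 : σ.card = 0
  · omega
  · have := this ⟨σ, hσ, by omega⟩
    unfold dimension
    omega

/-- The two bounds on the number `b` of backward edges among `g + 1` forward edges suffice. -/
theorem count_arith {D b g : ℕ} (h1 : g + b ≤ (g + 1) * D) (h2 : b ≤ g * D) :
    (D + 1) * b ≤ D ^ 2 * (g + 1) := by
  rcases le_total g D with h | h
  · calc (D + 1) * b ≤ (D + 1) * (g * D) := by gcongr
      _ = D ^ 2 * g + D * g := by ring
      _ ≤ D ^ 2 * g + D * D := by gcongr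
      _ = D ^ 2 * (g + 1) := by ring
  · have h3 : (D + 1) * (g + b) ≤ (D + 1) * ((g + 1) * D) := by gcongr
    nlinarith

/-- In a component, the forward edges other than the root and the backward edges have different
tails among the facets of the heads of the forward edges; and the tails of the backward edges are
among the facets of the heads of the forward edges other than the root. The head of a forward edge
has at most `dimension K` facets other than its tail. -/
theorem ComponentInv.count_component (hK : K.faces.Finite) (hM : IsMatching K M)
    (h : ComponentInv K M N X B ρ Q L) :
    (dimension K + 1) * {χ | χ ∈ M ∧ χ ∉ N ∧ χ.2 ∈ B}.ncard ≤
      dimension K ^ 2 * {χ | χ ∈ N ∧ χ.2 ∈ B}.ncard := by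
  classical
  have hMf := hM.finite hK
  have hFf : {χ | χ ∈ N ∧ χ.2 ∈ B}.Finite := hMf.subset fun χ hχ => h.sub hχ.1
  have hBf : {χ | χ ∈ M ∧ χ ∉ N ∧ χ.2 ∈ B}.Finite := hMf.subset fun χ hχ => hχ.1
  rw [Set.ncard_eq_toFinset_card _ hFf, Set.ncard_eq_toFinset_card _ hBf]
  set F := hFf.toFinset with hF
  set R := hBf.toFinset with hR
  have memF : ∀ χ, χ ∈ F ↔ χ ∈ N ∧ χ.2 ∈ B :=
    fun _ => Set.Finite.mem_toFinset _
  have memR : ∀ χ, χ ∈ R ↔ χ ∈ M ∧ χ ∉ N ∧ χ.2 ∈ B :=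
    fun _ => Set.Finite.mem_toFinset _
  have hρ : ρ ∈ F := (memF ρ).2 ⟨h.root_mem, h.root_head⟩
  let slots : Edge V → Finset (Finset V) := fun χ =>
    (χ.2.powersetCard χ.1.card).erase χ.1
  have hslots : ∀ χ ∈ F, (slots χ).card ≤ dimension K := by
    intro χ hχ
    obtain ⟨_, h2, h3⟩ := hM.1 χ (h.sub ((memF χ).1 hχ).1)
    have h4 := card_le_dimension hK h2
    have h5 : (χ.2.powersetCard χ.1.card).card = χ.1.card + 1 := by
      rw [Finset.card_powersetCard, h3.2, Nat.choose_succ_self_right]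
    have h6 := h3.2
    rw [Finset.card_erase_of_mem (Finset.mem_powersetCard.2 ⟨h3.1, rfl⟩), h5]
    omega
  have hmem : ∀ χ ∈ M, ∀ χ₀ ∈ N, χ₀ ≠ χ → IsFacet χ.1 χ₀.2 → χ.1 ∈ slots χ₀ := by
    intro χ hχ χ₀ hχ₀ hne hf
    refine Finset.mem_erase.2 ⟨fun he => hne (hM.eq_of_fst (h.sub hχ₀) hχ he.symm),
      Finset.mem_powersetCard.2 ⟨hf.1, ?_⟩⟩
    have := hf.2
    have := (hM.1 χ₀ (h.sub hχ₀)).2.2.2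
    omega
  have hinj : ∀ S : Finset (Edge V), (∀ χ ∈ S, χ ∈ M) → (S.image Prod.fst).card = S.card :=
    fun S hS => Finset.card_image_of_injOn fun χ h1 χ' h2 he =>
      hM.eq_of_fst (hS χ h1) (hS χ' h2) he
  have hdisj : Disjoint F R := Finset.disjoint_left.2 fun χ h1 h2 =>
    ((memR χ).1 h2).2.1 ((memF χ).1 h1).1
  have hA : F.card + R.card - 1 ≤ F.card * dimension K := by
    rw [← Finset.card_union_of_disjoint hdisj,
      ← Finset.card_erase_of_mem (Finset.mem_union_left _ hρ), ← hinj]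
    · refine (Finset.card_le_card ?_).trans (Finset.card_biUnion_le_card_mul F slots _ hslots)
      intro α hα
      obtain ⟨χ, hχ, rfl⟩ := Finset.mem_image.1 hα
      obtain ⟨hne, hχ⟩ := Finset.mem_erase.1 hχ
      have hχM : χ ∈ M ∧ χ.2 ∈ B := by
        rcases Finset.mem_union.1 hχ with hχ | hχ
        · exact ⟨h.sub ((memF χ).1 hχ).1, ((memF χ).1 hχ).2⟩
        · exact ⟨((memR χ).1 hχ).1, ((memR χ).1 hχ).2.2⟩
      obtain ⟨χ₀, h1, h2, h3, h4⟩ := h.slot χ hχM.1 hχM.2 hne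
      exact Finset.mem_biUnion.2 ⟨χ₀, (memF χ₀).2 ⟨h1, h2⟩, hmem χ hχM.1 χ₀ h1 h3 h4⟩
    · intro χ hχ
      rcases Finset.mem_union.1 (Finset.mem_erase.1 hχ).2 with hχ | hχ
      · exact h.sub ((memF χ).1 hχ).1
      · exact ((memR χ).1 hχ).1
  have hB : R.card ≤ (F.card - 1) * dimension K := by
    rw [← Finset.card_erase_of_mem hρ, ← hinj R fun χ hχ => ((memR χ).1 hχ).1]
    refine (Finset.card_le_card ?_).trans (Finset.card_biUnion_le_card_mul (F.erase ρ) slots _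
      fun χ hχ => hslots χ (Finset.mem_of_mem_erase hχ))
    intro α hα
    obtain ⟨χ, hχ, rfl⟩ := Finset.mem_image.1 hα
    obtain ⟨h5, h6, h7⟩ := (memR χ).1 hχ
    obtain ⟨χ₀, h1, h2, h3, h4⟩ := h.backward χ h5 h6 h7
    refine Finset.mem_biUnion.2 ⟨χ₀, Finset.mem_erase.2 ⟨h3, (memF χ₀).2 ⟨h1, h2⟩⟩,
      hmem χ h5 χ₀ h1 ?_ h4⟩
    rintro rfl
    exact h6 h1
  have hpos : 0 < F.card := Finset.card_pos.2 ⟨ρ, hρ⟩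
  obtain ⟨g, hg⟩ := Nat.exists_eq_succ_of_ne_zero hpos.ne'
  rw [hg] at hA hB ⊢
  refine count_arith ?_ ?_
  · have : g.succ + R.card - 1 = g + R.card := by omega
    rwa [this] at hA
  · simpa using hB

/-- The heads in `X` are never left, so a cycle that is not contained in `X` lies in the new
component. -/
theorem ComponentInv.return (hK : K.faces.Finite) (hM : IsMatching K M)
    (h : ComponentInv K M N X B ρ [] []) : DoneInv K M N (X ∪ B) where
  sub := h.sub
  closed := by
    rintro χ χ' h1 (h2 | h2)
    · exact .inl (h.closed χ χ' h1 h2)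
    · have := h.leaving χ χ' h1 h2 (by simp)
      simpa using this
  acyclic := by
    have key : ∀ χ χ', Relation.TransGen (LeadsIn N (X ∪ B)) χ χ' →
        (χ.2 ∈ X → Relation.TransGen (LeadsIn N X) χ χ') ∧ (χ'.2 ∉ X →
          Relation.TransGen (fun y z => (y, z) ∈ headEdges K N B) χ.2 χ'.2) := by
      intro χ χ' h1
      have hstep : ∀ χ χ', LeadsIn N (X ∪ B) χ χ' → χ'.2 ∉ X →
          Relation.TransGen (fun y z => (y, z) ∈ headEdges K N B) χ.2 χ'.2 := by
        intro χ χ' h2 h3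
        have h4 : χ.2 ∈ B := h2.2.1.resolve_left fun h4 => h3 (h.closed _ _ h2.1 h4)
        have h5 : χ'.2 ∈ B := h2.2.2.resolve_left h3
        refine .tail (b := χ'.1) (.single ?_) ?_
        · exact mem_headEdges_down hM h.sub h2.1.1 h2.1.2.1 h2.1.2.2.1 h2.1.2.2.2 h4
        · exact mem_headEdges_up hM h.sub h2.1.2.1 h5
      induction h1 with
      | single h2 => exact ⟨fun h3 => .single ⟨h2.1, h3, h.closed _ _ h2.1 h3⟩, hstep _ _ h2⟩
      | @tail χ₁ χ₂ h1 h2 ih =>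
        constructor
        · intro h3
          have h4 := ih.1 h3
          have h5 : χ₁.2 ∈ X := by
            obtain ⟨_, _, h5⟩ := Relation.TransGen.tail'_iff.1 h4
            exact h5.2.2
          exact h4.tail ⟨h2.1, h5, h.closed _ _ h2.1 h5⟩
        · intro h3
          exact (ih.2 fun h4 => h3 (h.closed _ _ h2.1 h4)).trans (hstep _ _ h2 h3)
    intro χ h1
    by_cases h2 : χ.2 ∈ X
    · exact h.acyclic χ ((key χ χ h1).1 h2)
    · exact h.noCycle ⟨χ.2, (key χ χ h1).2 h2⟩
  count := by
    have hMf := hM.finite hK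
    have h1 : {χ | χ ∈ M ∧ χ ∉ N ∧ χ.2 ∈ X ∪ B} =
        {χ | χ ∈ M ∧ χ ∉ N ∧ χ.2 ∈ X} ∪ {χ | χ ∈ M ∧ χ ∉ N ∧ χ.2 ∈ B} := by
      ext χ; simp only [Set.mem_union, Set.mem_ofPred_eq]; tauto
    have h2 : {χ | χ ∈ N ∧ χ.2 ∈ X ∪ B} = {χ | χ ∈ N ∧ χ.2 ∈ X} ∪ {χ | χ ∈ N ∧ χ.2 ∈ B} := by
      ext χ; simp only [Set.mem_union, Set.mem_ofPred_eq]; tauto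
    rw [h1, h2, Set.ncard_union_eq (s := {χ | χ ∈ N ∧ χ.2 ∈ X}) (Set.disjoint_left.2 fun χ h3 h4 => h.disjoint _ h4.2 h3.2)
      (hMf.subset fun χ hχ => h.sub hχ.1) (hMf.subset fun χ hχ => h.sub hχ.1), mul_add]
    calc _ ≤ (dimension K + 1) * ({χ | χ ∈ M ∧ χ ∉ N ∧ χ.2 ∈ X}.ncard +
            {χ | χ ∈ M ∧ χ ∉ N ∧ χ.2 ∈ B}.ncard) :=
          Nat.mul_le_mul_left _ (Set.ncard_union_le ..)
      _ ≤ _ := by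
          rw [mul_add]
          exact Nat.add_le_add h.count (h.count_component hK hM)

/-! ### Runs of the algorithm -/

/-- The configurations that the algorithm can reach in `k` steps. An up-edge accounts for at most
four steps, of which two remain when it is in the queue; the component of a call is empty until the
root is dequeued. -/
def StateInv (K : PreAbstractSimplicialComplex V) (M : Set (Edge V)) (k : ℕ) : State V → Prop
  | .main H G => ∃ N X, H = headEdges K N Xᶜ ∧ G = headEdges K N X ∧ DoneInv K M N X ∧
      (∀ χ ∈ M, χ ∉ N → χ.2 ∈ X) ∧ k + 4 * {χ | χ ∈ N ∧ χ.2 ∉ X}.ncard ≤ 4 * M.ncard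
  | .bfs H G C Q => ∃ N X B ρ, H = headEdges K N Xᶜ ∧ G = headEdges K N X ∧
      (C = headEdges K N B ∨ C = ∅ ∧ Q = [ρ] ∧ B = {ρ.2}) ∧ ComponentInv K M N X B ρ Q [] ∧
      k + 4 * {χ | χ ∈ N ∧ χ.2 ∉ X ∪ B}.ncard + 2 * Q.length + 1 ≤ 4 * M.ncard
  | .scan H G C Q L => ∃ N X B ρ, H = headEdges K N Xᶜ ∧ G = headEdges K N X ∧
      C = headEdges K N B ∧ ComponentInv K M N X B ρ Q L ∧
      k + 4 * {χ | χ ∈ N ∧ χ.2 ∉ X ∪ B}.ncard + 2 * Q.length + 2 ≤ 4 * M.ncard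
  | .halted G => ∃ N, N ⊆ M ∧ G = orientedHasse K N ∧ IsAcyclicMatching N ∧
      (dimension K + 1) * {χ | χ ∈ M ∧ χ ∉ N}.ncard ≤ dimension K ^ 2 * N.ncard ∧
      k ≤ 4 * M.ncard + 1

open scoped Fin.NatCast Fin.CommRing in
theorem isAcyclicMatching_of_leadsIn (hX : ∀ χ ∈ N, χ.2 ∈ X)
    (h : ∀ χ, ¬ Relation.TransGen (LeadsIn N X) χ χ) : IsAcyclicMatching N := by
  rintro ⟨n, a, b, hb, hab⟩
  have hstep : ∀ i, LeadsIn N X (a i, b i) (a (i + 1), b (i + 1)) := by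
    intro i
    refine ⟨⟨(hab i).1, (hab (i + 1)).1, fun he => ?_, (hab i).2⟩, hX _ (hab i).1,
      hX _ (hab (i + 1)).1⟩
    have := hb (congrArg Prod.snd he)
    simp at this
  have key : ∀ k : ℕ, Relation.TransGen (LeadsIn N X) (a 0, b 0)
      (a ((k + 1 : ℕ) : Fin (n + 2)), b ((k + 1 : ℕ) : Fin (n + 2))) := by
    intro k
    induction k with
    | zero => simpa using Relation.TransGen.single (hstep 0)
    | succ k ih =>
      have := ih.tail (hstep _)
      rwa [← Nat.cast_succ] at this
  have := key (n + 1)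
  rw [Fin.natCast_self] at this
  exact h _ this

/-- Classifying `χ` decreases the number of unclassified up-edges. -/
theorem ncard_unclassified_lt {N' : Set (Edge V)} {Y Z : Set (Finset V)} (hN : N.Finite)
    (hχ : χ ∈ N) (hY : χ.2 ∉ Y) (hN' : N' ⊆ N) (hZ : insert χ.2 Y ⊆ Z) :
    {χ' | χ' ∈ N' ∧ χ'.2 ∉ Z}.ncard < {χ' | χ' ∈ N ∧ χ'.2 ∉ Y}.ncard := by
  refine Set.ncard_lt_ncard ⟨fun χ' h => ⟨hN' h.1, fun h' => h.2 (hZ (.inr h'))⟩, fun h => ?_⟩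
    (hN.subset fun _ h => h.1)
  exact (h ⟨hχ, hY⟩ : χ ∈ N' ∧ χ.2 ∉ Z).2 (hZ (.inl rfl))

theorem StateInv.step (hK : K.faces.Finite) (hM : IsMatching K M) {k : ℕ} {s t : State V}
    (h : StateInv K M k s) (hst : Step s t) : StateInv K M (k + 1) t := by
  have hMf := hM.finite hK
  cases hst with
  | call H G χ hχ =>
    obtain ⟨N, X, rfl, rfl, h1, h2, h3⟩ := h
    rw [upEdges_headEdges (hM.mono h1.sub)] at hχ
    refine ⟨N, X, {χ.2}, χ, rfl, rfl, .inr ⟨rfl, rfl, rfl⟩, h1.call hM h2 hχ.1 hχ.2, ?_⟩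
    have := ncard_unclassified_lt (N' := N) (Z := X ∪ {χ.2}) (hMf.subset h1.sub) hχ.1 hχ.2
      subset_rfl (by rw [Set.union_comm]; rfl)
    simp only [List.length_singleton]
    omega
  | dequeue H G C C' χ₀ Q L hC' hL hmem =>
    obtain ⟨N, X, B, ρ, rfl, rfl, h1, h2, h3⟩ := h
    obtain ⟨h4, h5⟩ := h2.queue χ₀ (by simp)
    have h6 : C' = headEdges K N B := by
      rw [hC', facetEdges_headEdges (h2.disjoint _ h5)]
      rcases h1 with rfl | ⟨rfl, h1, rfl⟩
      · rw [headEdges_union, Set.union_singleton, Set.insert_eq_self.2 h5]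
      · rw [(List.cons.inj h1).1, Set.empty_union]
    refine ⟨N, X, B, ρ, rfl, rfl, h6, h2.dequeue hL fun χ => ?_, ?_⟩
    · rw [hmem, isLeadingUpEdge_headEdges hM h2.sub, h6]
      have h7 : Leads N χ₀ χ → (χ ∈ headEdges K N B ↔ χ.2 ∈ B) := by
        intro h8
        constructor
        · rintro (h9 | h9)
          · exact h9.2.2.2.2
          · exact absurd h9.2.2.1 (hM.1 χ (h2.sub h8.2.1)).2.2.not_swap
        · exact fun h9 => mem_headEdges_up hM h2.sub h8.2.1 h9
      have h8 : χ₀.2 ∈ Xᶜ := h2.disjoint _ h5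
      simp only [Set.mem_compl_iff] at h8 ⊢
      tauto
    · simp only [List.length_cons] at h3
      omega
  | backward H H' G C χ Q L hcyc hH' =>
    obtain ⟨N, X, B, ρ, rfl, rfl, rfl, h2, h3⟩ := h
    obtain ⟨h4, h5, h6, _⟩ := h2.list χ (by simp)
    obtain ⟨h7, h8, h9⟩ := hM.1 χ (h2.sub h4)
    have h10 : H' = headEdges K (N \ {χ}) Xᶜ := by rw [hH', reverseEdge_headEdges h7 h8 h9 h5]
    rw [facetEdges_headEdges h5, headEdges_union, Set.union_singleton] at hcyc
    refine ⟨N \ {χ}, X, insert χ.2 B, ρ, h10, (headEdges_erase h9 h5).symm, ?_,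
      h2.reverse hM hcyc, ?_⟩
    · rw [h10, facetEdges_headEdges h5, ← headEdges_erase (N := N) h9 h6, headEdges_union,
        Set.union_singleton]
    · have := ncard_unclassified_lt (N' := N \ {χ}) (Y := X ∪ B) (Z := X ∪ insert χ.2 B)
        (hMf.subset h2.sub) h4 (by simp [h5, h6]) Set.sdiff_subset (by simp [Set.union_insert])
      omega
  | forward H G C χ Q L hcyc =>
    obtain ⟨N, X, B, ρ, rfl, rfl, rfl, h2, h3⟩ := h
    obtain ⟨h4, h5, h6, _⟩ := h2.list χ (by simp)
    rw [facetEdges_headEdges h5, headEdges_union, Set.union_singleton] at hcyc ⊢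
    refine ⟨N, X, insert χ.2 B, ρ, rfl, rfl, rfl, h2.forward hM hcyc, ?_⟩
    have := ncard_unclassified_lt (N' := N) (Y := X ∪ B) (Z := X ∪ insert χ.2 B)
      (hMf.subset h2.sub) h4 (by simp [h5, h6]) subset_rfl (by simp [Set.union_insert])
    simp only [List.length_append, List.length_singleton]
    omega
  | endScan H G C Q =>
    obtain ⟨N, X, B, ρ, h0, h0', h1, h2, h3⟩ := h
    exact ⟨N, X, B, ρ, h0, h0', .inl h1, h2, by omega⟩
  | halt H G hH =>
    obtain ⟨N, X, rfl, rfl, h1, h2, h3⟩ := h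
    rw [upEdges_headEdges (hM.mono h1.sub)] at hH
    have hX : ∀ χ ∈ N, χ.2 ∈ X := by
      intro χ h4
      by_contra h5
      exact Set.notMem_empty χ (hH ▸ (⟨h4, h5⟩ : χ ∈ {χ | χ ∈ N ∧ χ.2 ∈ Xᶜ}))
    refine ⟨N, h1.sub, ?_, isAcyclicMatching_of_leadsIn hX h1.acyclic, ?_, by omega⟩
    · rw [headEdges_union, Set.union_compl_self, headEdges_univ]
    · have h4 : {χ | χ ∈ M ∧ χ ∉ N ∧ χ.2 ∈ X} = {χ | χ ∈ M ∧ χ ∉ N} := by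
        ext χ
        exact ⟨fun h => ⟨h.1, h.2.1⟩, fun h => ⟨h.1, h.2, h2 χ h.1 h.2⟩⟩
      have h5 : {χ | χ ∈ N ∧ χ.2 ∈ X} = N := by
        ext χ
        exact ⟨fun h => h.1, fun h => ⟨h, hX χ h⟩⟩
      have := h1.count
      rwa [h4, h5] at this
  | _ =>
    -- the remaining case is the return of a component
    rename_i H G C
    obtain ⟨N, X, B, ρ, rfl, rfl, h1, h2, h3⟩ := h
    replace h1 : C = headEdges K N B := by simpa using h1
    refine ⟨N, X ∪ B, ?_, ?_, h2.return hK hM, fun χ h4 h5 => h2.reversed χ h4 h5, ?_⟩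
    · rw [h1, headEdges_diff, Set.compl_union]; rfl
    · rw [h1, headEdges_union]
    · simp only [List.length_nil] at h3
      omega

theorem StateInv.of_run (hK : K.faces.Finite) (hM : IsMatching K M) {k : ℕ} {s t : State V}
    (h : Run k s t) (hs : s = initial K M) : StateInv K M k t := by
  induction h with
  | refl =>
    subst hs
    refine ⟨M, ∅, ?_, headEdges_empty.symm, .start, fun χ h1 h2 => absurd h1 h2, ?_⟩
    · rw [Set.compl_empty, headEdges_univ]
    · simp
  | tail _ h' ih => exact (ih hs).step hK hM h'

theorem StateInv.le {k : ℕ} {s : State V} (h : StateInv K M k s) : k ≤ 4 * M.ncard + 1 := by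
  cases s with
  | main H G => obtain ⟨_, _, _, _, _, _, h⟩ := h; omega
  | bfs H G C Q => obtain ⟨_, _, _, _, _, _, _, _, h⟩ := h; omega
  | scan H G C Q L => obtain ⟨_, _, _, _, _, _, _, _, h⟩ := h; omega
  | halted G => obtain ⟨_, _, _, _, _, h⟩ := h; exact h

theorem StateInv.progress (hK : K.faces.Finite) (hM : IsMatching K M) {k : ℕ} {s : State V}
    (h : StateInv K M k s) : (∃ G, s = .halted G) ∨ ∃ t, Step s t := by
  cases s with
  | main H G =>
    rcases (upEdges H).eq_empty_or_nonempty with h1 | ⟨χ, h1⟩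
    · exact .inr ⟨_, .halt H G h1⟩
    · exact .inr ⟨_, .call H G χ h1⟩
  | bfs H G C Q =>
    cases Q with
    | nil => exact .inr ⟨_, .return H G C⟩
    | cons χ₀ Q =>
      obtain ⟨N, X, B, ρ, rfl, rfl, h1, h2, h3⟩ := h
      have hf : {χ | IsLeadingUpEdge (headEdges K N Xᶜ) χ₀ χ ∧
          χ ∉ C ∪ facetEdges (headEdges K N Xᶜ) χ₀.2}.Finite := by
        refine (hM.finite hK).subset fun χ hχ => ?_
        have := (isLeadingUpEdge_headEdges hM h2.sub).1 hχ.1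
        exact h2.sub this.1.2.1
      exact .inr ⟨_, .dequeue _ _ C _ χ₀ Q hf.toFinset.toList rfl (Finset.nodup_toList _)
        (by simp)⟩
  | scan H G C Q L =>
    cases L with
    | nil => exact .inr ⟨_, .endScan H G C Q⟩
    | cons χ L =>
      by_cases hcyc : HasCycle (C ∪ facetEdges H χ.2)
      · exact .inr ⟨_, .backward H _ G C χ Q L hcyc rfl⟩
      · exact .inr ⟨_, .forward H G C χ Q L hcyc⟩
  | halted G => exact .inl ⟨G, rfl⟩

theorem IsMatching.ncard_matchedSimplices (hK : K.faces.Finite) (hM : IsMatching K M) :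
    (matchedSimplices M).ncard = 2 * M.ncard := by
  have hMf := hM.finite hK
  have h1 : matchedSimplices M = Prod.fst '' M ∪ Prod.snd '' M := by
    ext σ
    simp only [matchedSimplices, Set.mem_ofPred_eq, Set.mem_union, Set.mem_image]
    constructor
    · rintro ⟨p, hp, rfl | rfl⟩
      exacts [.inl ⟨p, hp, rfl⟩, .inr ⟨p, hp, rfl⟩]
    · rintro (⟨p, hp, rfl⟩ | ⟨p, hp, rfl⟩)
      exacts [⟨p, hp, .inl rfl⟩, ⟨p, hp, .inr rfl⟩]
  have h2 : Disjoint (Prod.fst '' M) (Prod.snd '' M) := by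
    refine Set.disjoint_left.2 ?_
    rintro _ ⟨p, hp, rfl⟩ ⟨q, hq, hpq⟩
    obtain rfl := hM.2 p hp q hq p.1 (.inl rfl) (.inr hpq.symm)
    exact (hM.1 p hp).2.2.ne hpq.symm
  rw [h1, Set.ncard_union_eq h2 (hMf.image _) (hMf.image _),
    Set.InjOn.ncard_image fun p hp q hq => hM.eq_of_fst hp hq,
    Set.InjOn.ncard_image fun p hp q hq => hM.eq_of_snd hp hq, two_mul]

theorem IsMatching.two_mul_ncard_le (hK : K.faces.Finite) (hM : IsMatching K M) :
    2 * M.ncard ≤ K.faces.ncard := by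
  rw [← hM.ncard_matchedSimplices hK]
  refine Set.ncard_le_ncard ?_ hK
  rintro σ ⟨p, hp, rfl | rfl⟩
  exacts [(hM.1 p hp).1, (hM.1 p hp).2.1]

theorem run_le_and_progress (hK : K.faces.Finite) (hM : IsMatching K M) {k : ℕ} {s : State V}
    (h : Run k (initial K M) s) :
    k ≤ 2 * K.faces.ncard + 1 ∧ ((∃ G, s = .halted G) ∨ ∃ t, Step s t) := by
  have h1 := StateInv.of_run hK hM h rfl
  have h2 := hM.two_mul_ncard_le hK
  have h3 := h1.le
  exact ⟨by omega, h1.progress hK hM⟩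

theorem approx_of_run (hK : K.faces.Finite) (hM : IsMaximumMatching K M) {k : ℕ}
    {G : Set (Edge V)} (h : Run k (initial K M) (.halted G)) :
    G = orientedHasse K (upEdges G) ∧
      IsApproxMaxMorseMatching K
        (((dimension K : ℚ) + 1) / ((dimension K : ℚ) ^ 2 + (dimension K : ℚ) + 1))
        (upEdges G) := by
  obtain ⟨N, hN, rfl, hacyc, hcount, _⟩ := StateInv.of_run hK hM.1 h rfl
  have hNM := hM.1.mono hN
  have hup : upEdges (orientedHasse K N) = N := by
    rw [← headEdges_univ, upEdges_headEdges hNM]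
    simp
  rw [hup]
  refine ⟨rfl, ⟨hNM, hacyc⟩, fun N' hN' => ?_⟩
  rw [hN'.1.ncard_matchedSimplices hK, hNM.ncard_matchedSimplices hK]
  have h1 : {χ | χ ∈ M ∧ χ ∉ N}.ncard + N.ncard = M.ncard :=
    Set.ncard_sdiff_add_ncard_of_subset hN (hM.1.finite hK)
  have h2 := hM.2 N' hN'.1
  have h3 : (dimension K + 1) * N'.ncard ≤ (dimension K ^ 2 + dimension K + 1) * N.ncard := by
    calc _ ≤ (dimension K + 1) * M.ncard := by gcongr
      _ = (dimension K + 1) * {χ | χ ∈ M ∧ χ ∉ N}.ncard + (dimension K + 1) * N.ncard := by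
        rw [← h1]; ring
      _ ≤ dimension K ^ 2 * N.ncard + (dimension K + 1) * N.ncard := by gcongr
      _ = _ := by ring
  have h4 : ((dimension K : ℚ) + 1) * N'.ncard ≤
      ((dimension K : ℚ) ^ 2 + dimension K + 1) * N.ncard := by exact_mod_cast h3
  rw [div_mul_eq_mul_div, div_le_iff₀ (by positivity)]
  push_cast
  linarith

end

/-! ### Maximum bipartite matchings by an auction -/

section
variable {α β : Type} [DecidableEq β]

/-- The price of `b` when `P` lists the items sold so far: the number of times that `b` has been
sold. -/
def price (P : List β) (b : β) : ℕ := (P.filter (fun x => x = b)).length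

theorem price_eq_count (P : List β) (b : β) : price P b = P.count b := by
  rw [price, List.count_eq_countP, List.countP_eq_length_filter]
  rfl

theorem price_cons (P : List β) (a b : β) :
    price (a :: P) b = price P b + if a = b then 1 else 0 := by
  rw [price_eq_count, price_eq_count, List.count_cons]
  simp

/-- Edges of a bipartite graph that pairwise have no common vertex. -/
def IsBipartiteMatching (N : Set (α × β)) : Prop :=
  ∀ e ∈ N, ∀ f ∈ N, e.1 = f.1 ∨ e.2 = f.2 → e = f

/-- The invariants of the auction. By `slack`, nobody would be better off by more than one unit with
another item. -/
structure AuctionInv (E : List (α × β)) (s : List (α × β) × List β) : Prop where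
  sub : s.1 ⊆ E
  nodup : s.1.Nodup
  matching : IsBipartiteMatching {e | e ∈ s.1}
  slack : ∀ e ∈ s.1, ∀ f ∈ E, f.1 = e.1 → price s.2 e.2 ≤ price s.2 f.2 + 1
  sold : ∀ b ∈ s.2, ∃ e ∈ s.1, e.2 = b
  price_le : ∀ b, price s.2 b ≤ E.length + 1
  sold_sub : s.2 ⊆ E.map Prod.snd

theorem AuctionInv.start (E : List (α × β)) : AuctionInv E ([], []) where
  sub := by simp
  nodup := by simp
  matching := by simp [IsBipartiteMatching]
  slack := by simp
  sold := by simp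
  price_le := by simp [price]
  sold_sub := by simp

theorem AuctionInv.length_sold_le {E : List (α × β)} {s : List (α × β) × List β}
    (h : AuctionInv E s) : s.2.length ≤ E.length * (E.length + 1) := by
  rw [← List.sum_toFinset_count_eq_length]
  refine (Finset.sum_le_card_nsmul _ _ (E.length + 1) fun b _ => ?_).trans ?_
  · rw [← price_eq_count]; exact h.price_le b
  · rw [smul_eq_mul]
    gcongr
    refine (Finset.card_le_card (t := (E.map Prod.snd).toFinset) fun b hb => ?_).trans ?_
    · rw [List.mem_toFinset] at hb ⊢
      exact h.sold_sub hb
    · exact (List.toFinset_card_le _).trans (by simp)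

variable [DecidableEq α]

/-- The edges `e` such that `e.1` is unmatched and `e.2` is one of its cheapest neighbours, unless
that is too expensive. -/
def bids (E : List (α × β)) (s : List (α × β) × List β) : List (α × β) :=
  E.filter (fun e => (∀ f ∈ s.1, ¬ f.1 = e.1) ∧
    (∀ f ∈ E, ¬ f.1 = e.1 ∨ price s.2 e.2 ≤ price s.2 f.2) ∧ price s.2 e.2 ≤ E.length)

/-- One step of the auction for the bipartite graph `E`: an unmatched vertex on the left takes its
cheapest neighbour, whose price rises, from the present partner. The state consists of the matching
and of the list of the items sold so far. -/
def auctionStep (E : List (α × β)) (s : List (α × β) × List β) : List (α × β) × List β :=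
  listCase (bids E s) s (fun e _ => (e :: s.1.filter (fun f => ¬ f.2 = e.2), e.2 :: s.2))

theorem AuctionInv.step {E : List (α × β)} {s : List (α × β) × List β} (h : AuctionInv E s) :
    AuctionInv E (auctionStep E s) := by
  rw [auctionStep]
  cases hb : bids E s with
  | nil => exact h
  | cons e l =>
    have he : e ∈ bids E s := by simp [hb]
    simp only [bids, List.mem_filter, decide_eq_true_eq] at he
    obtain ⟨heE, hfree, hmin, hcap⟩ := he
    rw [listCase_cons]
    exact
    { sub := by
        intro f hf
        rcases List.mem_cons.1 hf with rfl | hf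
        · exact heE
        · exact h.sub (List.mem_filter.1 hf).1
      nodup := by
        refine List.nodup_cons.2 ⟨fun hf => ?_, h.nodup.filter _⟩
        simp at hf
      matching := by
        intro f hf g hg hfg
        simp only [Set.mem_ofPred_eq, List.mem_cons, List.mem_filter, decide_eq_true_eq] at hf hg
        rcases hf with rfl | ⟨hf, hf'⟩ <;> rcases hg with rfl | ⟨hg, hg'⟩
        · rfl
        · rcases hfg with hfg | hfg
          · exact absurd hfg.symm (hfree g hg)
          · exact absurd hfg.symm hg'
        · rcases hfg with hfg | hfg
          · exact absurd hfg (hfree f hf)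
          · exact absurd hfg hf'
        · exact h.matching f hf g hg hfg
      slack := by
        intro f hf g hg hfg
        simp only [price_cons]
        simp only [List.mem_cons, List.mem_filter, decide_eq_true_eq] at hf
        rcases hf with rfl | ⟨hf, hf'⟩
        · have := (hmin g hg).resolve_left (fun h => h hfg)
          rw [if_pos rfl]
          omega
        · have := h.slack f hf g hg hfg
          rw [if_neg (Ne.symm hf')]
          omega
      sold := by
        intro b hb
        by_cases hbe : b = e.2
        · exact ⟨e, by simp, hbe.symm⟩
        · obtain ⟨f, hf, rfl⟩ := h.sold b ((List.mem_cons.1 hb).resolve_left hbe)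
          exact ⟨f, by simp [hf, hbe], rfl⟩
      price_le := by
        intro b
        have := h.price_le b
        simp only [price_cons]
        split
        · subst b; omega
        · omega
      sold_sub := List.cons_subset.2 ⟨List.mem_map_of_mem heE, h.sold_sub⟩ }

/-- Some price level `k` is skipped. When nobody bids any more, the items above level `k` and the
left vertices with a neighbour below level `k` cover all edges, and every edge of the matching covers
with only one of its ends. -/
theorem AuctionInv.card_le {E : List (α × β)} {s : List (α × β) × List β} (h : AuctionInv E s)
    (hb : bids E s = []) {N : Finset (α × β)} (hNE : ∀ e ∈ N, e ∈ E)
    (hN : IsBipartiteMatching (N : Set (α × β))) : N.card ≤ s.1.length := by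
  obtain ⟨k, hk, hk'⟩ : ∃ k ∈ Finset.Icc 1 (E.length + 1),
      k ∉ (E.map Prod.snd).toFinset.image (price s.2) := by
    refine Finset.exists_mem_notMem_of_card_lt_card ?_
    calc _ ≤ (E.map Prod.snd).toFinset.card := Finset.card_image_le
      _ ≤ (E.map Prod.snd).length := List.toFinset_card_le _
      _ < _ := by simp
  rw [Finset.mem_Icc] at hk
  have hgap : ∀ e ∈ E, price s.2 e.2 ≠ k := fun e he hek => hk' (Finset.mem_image.2
    ⟨e.2, List.mem_toFinset.2 (List.mem_map_of_mem he), hek⟩)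
  have key : ∀ e : α × β, ∃ f, e ∈ N → f ∈ s.1 ∧ ((k < price s.2 e.2 ∧ f.2 = e.2) ∨
      (f.1 = e.1 ∧ price s.2 f.2 < k)) := by
    intro e
    by_cases heN : e ∈ N
    · have heE := hNE e heN
      rcases lt_or_gt_of_ne (hgap e heE) with hlt | hgt
      · obtain ⟨f, hf, hfe⟩ : ∃ f ∈ s.1, f.1 = e.1 := by
          by_contra hfree
          push Not at hfree
          obtain ⟨g, hg, hmin⟩ := (E.toFinset.filter (fun g => g.1 = e.1)).exists_min_image
            (fun g => price s.2 g.2) ⟨e, by simp [heE]⟩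
          simp only [Finset.mem_filter, List.mem_toFinset] at hg hmin
          have h1 := hmin e ⟨heE, rfl⟩
          have h2 : g ∈ bids E s := by
            simp only [bids, List.mem_filter, decide_eq_true_eq]
            refine ⟨hg.1, fun f hf => ?_, fun f hf => ?_, by omega⟩
            · rw [hg.2]; exact hfree f hf
            · rw [hg.2]
              by_cases hfe : f.1 = e.1
              · exact .inr (hmin f ⟨hf, hfe⟩)
              · exact .inl hfe
          simp [hb] at h2
        have h1 := h.slack f hf e heE hfe.symm
        have h2 := hgap f (h.sub hf)
        exact ⟨f, fun _ => ⟨hf, .inr ⟨hfe, by omega⟩⟩⟩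
      · have h1 : e.2 ∈ s.2 := by
          rw [← List.count_pos_iff, ← price_eq_count]
          omega
        obtain ⟨f, hf, hfe⟩ := h.sold e.2 h1
        exact ⟨f, fun _ => ⟨hf, .inl ⟨hgt, hfe⟩⟩⟩
    · exact ⟨e, fun h => absurd h heN⟩
  choose φ hφ using key
  rw [← List.toFinset_card_of_nodup h.nodup]
  refine Finset.card_le_card_of_injOn φ (fun e he => ?_) fun e he e' he' hee' => ?_
  · simpa using (hφ e he).1
  · have h1 := (hφ e he).2
    have h2 := (hφ e' he').2
    rw [← hee'] at h2
    refine hN e he e' he' ?_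
    rcases h1 with ⟨h1, h3⟩ | ⟨h1, h3⟩ <;> rcases h2 with ⟨h2, h4⟩ | ⟨h2, h4⟩
    · exact .inr (h3.symm.trans h4)
    · rw [← h3] at h1; omega
    · rw [← h4] at h2; omega
    · exact .inl (h1.symm.trans h2)

/-- The number `(E.length + 1) ^ 2` of rounds in an auction, in the form of a list. -/
def rounds {γ : Type} (E : List γ) : List (Unit × Unit) :=
  (() :: E.map (fun _ => ())).product (() :: E.map (fun _ => ()))

/-- The matching found by the auction. -/
def auction (E : List (α × β)) : List (α × β) :=
  ((rounds E).foldl (fun s _ => auctionStep E s) ([], [])).1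

theorem auction_spec (E : List (α × β)) : ∃ P, AuctionInv E (auction E, P) ∧
    bids E (auction E, P) = [] := by
  rw [auction, List.foldl_const]
  have key : ∀ i, AuctionInv E ((auctionStep E)^[i] ([], [])) ∧
      (bids E ((auctionStep E)^[i] ([], [])) = [] ∨
        i ≤ ((auctionStep E)^[i] ([], [])).2.length) := by
    intro i
    induction i with
    | zero => exact ⟨.start E, .inr le_rfl⟩
    | succ i ih =>
      rw [Function.iterate_succ_apply']
      refine ⟨ih.1.step, ?_⟩
      set s := (auctionStep E)^[i] ([], [])
      cases hb : bids E s with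
      | nil => exact .inl (by rw [auctionStep, hb]; exact hb)
      | cons e l =>
        have := ih.2.resolve_left (by simp [hb])
        refine .inr ?_
        rw [auctionStep, hb]
        simpa using this
  obtain ⟨h1, h2⟩ := key (rounds E).length
  refine ⟨_, h1, h2.resolve_right fun h3 => ?_⟩
  have h4 := h1.length_sold_le
  have h5 : (rounds E).length = (E.length + 1) * (E.length + 1) := by
    exact (List.length_product _ _).trans (by simp)
  have h6 := h5 ▸ h3.trans h4
  nlinarith

end

/-! ### Maximum matchings of the Hasse graph -/

section
variable {V : Type} {K : PreAbstractSimplicialComplex V}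

/-- The edge of the Hasse graph as an edge of a bipartite graph, with the simplex of even cardinality
first. -/
def evenFirst (e : Edge V) : Edge V := if Even e.1.card then e else (e.2, e.1)

theorem evenFirst_eq {e : Edge V} (he : IsFacet e.1 e.2) {σ : Finset V} (hσ : σ = e.1 ∨ σ = e.2) :
    (Even σ.card → (evenFirst e).1 = σ) ∧ (¬ Even σ.card → (evenFirst e).2 = σ) := by
  have h1 : Even e.2.card ↔ ¬ Even e.1.card := by rw [he.2, Nat.even_add_one]
  unfold evenFirst
  by_cases h : Even e.1.card <;> rcases hσ with rfl | rfl <;> simp [h, h1]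

theorem evenFirst_injOn {e f : Edge V} (he : IsFacet e.1 e.2) (hf : IsFacet f.1 f.2)
    (h : evenFirst e = evenFirst f) : e = f := by
  unfold evenFirst at h
  split at h <;> split at h
  · exact h
  · subst h; exact absurd he hf.not_swap
  · subst h; exact absurd hf he.not_swap
  · exact Prod.ext (congrArg Prod.snd h) (congrArg Prod.fst h)

theorem common_iff_evenFirst {e f : Edge V} (he : IsFacet e.1 e.2) (hf : IsFacet f.1 f.2) :
    (∃ σ, (σ = e.1 ∨ σ = e.2) ∧ (σ = f.1 ∨ σ = f.2)) ↔
      (evenFirst e).1 = (evenFirst f).1 ∨ (evenFirst e).2 = (evenFirst f).2 := by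
  constructor
  · rintro ⟨σ, h1, h2⟩
    have h3 := evenFirst_eq he h1
    have h4 := evenFirst_eq hf h2
    by_cases h : Even σ.card
    · exact .inl ((h3.1 h).trans (h4.1 h).symm)
    · exact .inr ((h3.2 h).trans (h4.2 h).symm)
  · have key : ∀ g : Edge V, ((evenFirst g).1 = g.1 ∨ (evenFirst g).1 = g.2) ∧
        ((evenFirst g).2 = g.1 ∨ (evenFirst g).2 = g.2) := by
      intro g
      unfold evenFirst
      split <;> simp
    rintro (h | h)
    · exact ⟨_, (key e).1, h ▸ (key f).1⟩
    · exact ⟨_, (key e).2, h ▸ (key f).2⟩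

variable [DecidableEq V]

/-- The pairs `(σ, τ)` of simplices in `L` such that `σ` is a facet of `τ`. -/
def hasseList (L : List (Finset V)) : List (Edge V) :=
  (L.product L).filter (fun e => IsFacet e.1 e.2)

/-- A maximum matching of the Hasse graph of the complex with the faces `L`. -/
def maximumMatching (L : List (Finset V)) : List (Edge V) :=
  (hasseList L).filter (fun e => evenFirst e ∈ auction ((hasseList L).map evenFirst))

theorem isMaximumMatching_maximumMatching {L : List (Finset V)}
    (hL : ∀ σ, σ ∈ K.faces ↔ σ ∈ L) : IsMaximumMatching K {e | e ∈ maximumMatching L} := by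
  obtain ⟨P, hinv, hbids⟩ := auction_spec ((hasseList L).map evenFirst)
  have hmem : ∀ e, e ∈ hasseList L ↔ e.1 ∈ K.faces ∧ e.2 ∈ K.faces ∧ IsFacet e.1 e.2 := by
    intro e
    rw [hasseList, List.mem_filter, hL, hL, List.pair_mem_product (xs := L) (ys := L)]
    simp [and_assoc]
  have hmem' : ∀ e ∈ maximumMatching L, e ∈ hasseList L ∧
      evenFirst e ∈ auction ((hasseList L).map evenFirst) := by
    intro e he
    simpa [maximumMatching] using he
  refine ⟨⟨fun e he => (hmem e).1 (hmem' e he).1, fun e he f hf σ h1 h2 => ?_⟩, fun N hN => ?_⟩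
  · have he' := ((hmem e).1 (hmem' e he).1).2.2
    have hf' := ((hmem f).1 (hmem' f hf).1).2.2
    exact evenFirst_injOn he' hf' (hinv.matching _ (hmem' e he).2 _ (hmem' f hf).2
      ((common_iff_evenFirst he' hf').1 ⟨σ, h1, h2⟩))
  · have hNf : N.Finite := by
      refine (List.finite_toSet (hasseList L)).subset fun e he => ?_
      exact (hmem e).2 (hN.1 e he)
    have hcard : (hNf.toFinset.image evenFirst).card = hNf.toFinset.card := by
      refine Finset.card_image_of_injOn fun e he f hf hef => ?_
      simp only [Set.Finite.coe_toFinset] at he hf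
      exact evenFirst_injOn (hN.1 e he).2.2 (hN.1 f hf).2.2 hef
    rw [Set.ncard_eq_toFinset_card _ hNf, ← hcard]
    refine (hinv.card_le hbids (fun e he => ?_) fun e he f hf hef => ?_).trans ?_
    · obtain ⟨f, hf, rfl⟩ := Finset.mem_image.1 he
      exact List.mem_map_of_mem ((hmem f).2 (hN.1 f (by simpa using hf)))
    · obtain ⟨p, hp, rfl⟩ := Finset.mem_image.1 he
      obtain ⟨q, hq, rfl⟩ := Finset.mem_image.1 hf
      rw [Set.Finite.mem_toFinset] at hp hq
      obtain ⟨σ, h1, h2⟩ := (common_iff_evenFirst (hN.1 p hp).2.2 (hN.1 q hq).2.2).2 hef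
      rw [hN.2 p hp q hq σ h1 h2]
    · rw [← List.toFinset_card_of_nodup hinv.nodup]
      have h1 : (auction ((hasseList L).map evenFirst)).toFinset ⊆
          (maximumMatching L).toFinset.image evenFirst := by
        intro f hf
        rw [List.mem_toFinset] at hf
        obtain ⟨e, he, rfl⟩ := List.mem_map.1 (hinv.sub hf)
        exact Finset.mem_image.2 ⟨e, by simp [maximumMatching, he, hf], rfl⟩
      refine (Finset.card_le_card h1).trans (Finset.card_image_le.trans ?_)
      rw [← Set.ncard_coe_finset]
      simp

end

/-! ### The auction runs in polynomial time -/

section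
variable {α β γ : Type} [Data α] [Data β] [Data γ]
open Polynomial Data

@[fun_prop] theorem PolyTime.product {f : α → List β} {g : α → List γ} (hf : PolyTime f)
    (hg : PolyTime g) : PolyTime (fun x => (f x).product (g x)) := by
  have hfold : ∀ (r : List γ) (l : List β) (s : List (β × γ)),
      l.foldl (fun s b => s ++ r.map (fun c => (b, c))) s = s ++ l.product r := by
    intro r l
    induction l with
    | nil => intro s; simp [List.product]
    | cons b l ih => intro s; simp [ih, List.product]
  have : PolyTime (fun x : α =>
      (f x).foldl (fun s b => s ++ (g x).map (fun c => (b, c))) []) := by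
    refine .foldl (c := g) (f := fun r s b => s ++ r.map (fun c => (b, c))) (by fun_prop)
      ⟨X + X * X, fun m r s l hr hs hl => ?_⟩ hg .nil hf
    rw [hfold, size_list_le]
    simp only [eval_add, eval_mul, eval_X]
    constructor
    · rw [List.length_append, show (l.product r).length = _ from List.length_product l r]
      have h1 := (length_le_size s).trans hs
      have h2 := Nat.mul_le_mul ((length_le_size l).trans hl) ((length_le_size r).trans hr)
      omega
    · intro y hy
      rcases List.mem_append.1 hy with hy | hy
      · have := (size_le_of_mem hy).trans hs
        omega
      · obtain ⟨h1, h2⟩ := List.pair_mem_product.1 (show (y.1, y.2) ∈ _ from hy)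
        have h3 := (size_le_of_mem h1).trans hl
        have h4 := (size_le_of_mem h2).trans hr
        rw [size_prod]
        omega
  simpa [hfold] using this

theorem size_auctionStep_le [DecidableEq β] [DecidableEq γ] (E : List (β × γ))
    (s : List (β × γ) × List γ) :
    size (auctionStep E s) ≤ max (size E) (size s + 1) := by
  rw [auctionStep]
  cases hb : bids E s with
  | nil => exact le_max_of_le_right (Nat.le_succ _)
  | cons e l =>
    have he : e ∈ E := List.mem_of_mem_filter (p := _) (show e ∈ bids E s by simp [hb])
    have h1 := size_le_of_mem he
    have h2 := size_cons e (s.1.filter (fun f => ¬ f.2 = e.2))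
    have h3 := size_cons e.2 s.2
    have h4 := size_filter_le s.1 (fun f => ¬ f.2 = e.2)
    simp only [listCase_cons, size_prod] at *
    omega

variable [DecidableEq β] [DataEq β]

@[fun_prop] theorem PolyPred.price_le {f g : α → List β} {b c : α → β} (hf : PolyTime f)
    (hg : PolyTime g) (hb : PolyTime b) (hc : PolyTime c) :
    PolyPred (fun x => price (f x) (b x) ≤ price (g x) (c x)) := by
  unfold price
  fun_prop

@[fun_prop] theorem PolyPred.price_le_length {f : α → List β} {g : α → List γ} {b : α → β}
    (hf : PolyTime f) (hg : PolyTime g) (hb : PolyTime b) :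
    PolyPred (fun x => price (f x) (b x) ≤ (g x).length) := by
  unfold price
  fun_prop

variable [DecidableEq γ] [DataEq γ]

theorem polyTime_auctionStep :
    PolyTime (fun z : List (β × γ) × (List (β × γ) × List γ) => auctionStep z.1 z.2) := by
  unfold auctionStep bids
  fun_prop

@[fun_prop] theorem PolyTime.auction {f : α → List (β × γ)} (hf : PolyTime f) :
    PolyTime (fun x => auction (f x)) := by
  unfold FrontierEdges.auction rounds
  refine .fst (.foldl_of_size_le (f := fun E s _ => auctionStep E s) ?_ X (fun E s _ => ?_) hf
    (by fun_prop) (by fun_prop))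
  · exact polyTime_auctionStep.comp
      (f := fun z : List (β × γ) × ((List (β × γ) × List γ) × (Unit × Unit)) => (z.1, z.2.1))
      (by fun_prop)
  · have := size_auctionStep_le E s
    simp only [eval_X]
    omega

@[fun_prop] theorem PolyTime.maximumMatching {f : α → List (Finset ℕ)} (hf : PolyTime f) :
    PolyTime (fun x => maximumMatching (f x)) := by
  unfold FrontierEdges.maximumMatching hasseList evenFirst
  fun_prop

end

section
variable {V : Type}

/-! ### Configurations made of lists -/

/-- The data `H`, `G`, `C`, `Q`, `L` of a configuration of the algorithm. -/
abbrev Config (V : Type) := List (Edge V) × List (Edge V) × List (Edge V) × List (Edge V) ×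
  List (Edge V)

/-- The state of the algorithm that a configuration stands for: loops that are about to end have
ended. -/
def resume : Config V → State V
  | (H, G, C, [], []) => .main ({e | e ∈ H} \ {e | e ∈ C}) ({e | e ∈ G} ∪ {e | e ∈ C})
  | (H, G, C, χ₀ :: Q, []) => .bfs {e | e ∈ H} {e | e ∈ G} {e | e ∈ C} (χ₀ :: Q)
  | (H, G, C, Q, χ :: L) => .scan {e | e ∈ H} {e | e ∈ G} {e | e ∈ C} Q (χ :: L)

theorem run_resume_of_bfs {k : ℕ} {s : State V} {H G C Q : List (Edge V)}
    (h : Run k s (.bfs {e | e ∈ H} {e | e ∈ G} {e | e ∈ C} Q)) :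
    ∃ k' ≥ k, Run k' s (resume (H, G, C, Q, [])) := by
  cases Q with
  | nil => exact ⟨_, Nat.le_succ k, h.tail (.return _ _ _)⟩
  | cons χ Q => exact ⟨k, le_rfl, h⟩

theorem run_resume_of_scan {k : ℕ} {s : State V} {H G C Q L : List (Edge V)}
    (h : Run k s (.scan {e | e ∈ H} {e | e ∈ G} {e | e ∈ C} Q L)) :
    ∃ k' ≥ k, Run k' s (resume (H, G, C, Q, L)) := by
  cases L with
  | nil =>
    obtain ⟨k', h1, h2⟩ := run_resume_of_bfs (h.tail (.endScan _ _ _ _))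
    exact ⟨k', by omega, h2⟩
  | cons χ L => exact ⟨k, le_rfl, by cases Q <;> exact h⟩

variable [DecidableEq V]

/-! ### Detecting cycles -/

/-- The edges whose heads are tails of edges of the graph. -/
def peel (s : List (Edge V)) : List (Edge V) :=
  s.filter (fun e => ∃ f ∈ s, f.1 = e.2)

/-- What remains of a graph when edges into sinks are removed as long as there are any. -/
def peelAll (s : List (Edge V)) : List (Edge V) :=
  s.foldl (fun t _ => peel t) s

theorem peel_peelAll (s : List (Edge V)) : peel (peelAll s) = peelAll s := by
  rw [peelAll, List.foldl_const]
  have key : ∀ i, peel (peel^[i] s) = peel^[i] s ∨ (peel^[i] s).length + i ≤ s.length := by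
    intro i
    induction i with
    | zero => simp
    | succ i ih =>
      rw [Function.iterate_succ_apply']
      set t := peel^[i] s
      by_cases h : peel t = t
      · exact .inl (by rw [h, h])
      · have h1 := ih.resolve_left h
        have h2 : (peel t).length ≠ t.length := fun h2 =>
          h (List.Sublist.eq_of_length List.filter_sublist h2)
        have h3 : (peel t).length ≤ t.length := List.length_filter_le ..
        exact .inr (by omega)
  rcases key s.length with h | h
  · exact h
  · have h1 : (peel^[s.length] s).length = 0 := by omega
    rw [List.length_eq_zero_iff] at h1
    rw [h1]
    rfl

theorem peelAll_subset (s : List (Edge V)) : peelAll s ⊆ s := by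
  rw [peelAll, List.foldl_const]
  have key : ∀ i, peel^[i] s ⊆ s := by
    intro i
    induction i with
    | zero => simp
    | succ i ih =>
      rw [Function.iterate_succ_apply']
      exact List.Subset.trans (List.filter_subset_self ..) ih
  exact key _

/-- Edges on a cycle are never removed; and if edges remain, then following them leads to a cycle. -/
theorem hasCycle_iff_peelAll (s : List (Edge V)) :
    HasCycle {e | e ∈ s} ↔ peelAll s ≠ [] := by
  set R : Finset V → Finset V → Prop := fun y z => (y, z) ∈ s with hR
  constructor
  · rintro ⟨x, hx⟩ hnil
    have key : ∀ i, ∀ e ∈ s, Relation.ReflTransGen R e.2 e.1 → e ∈ peel^[i] s := by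
      intro i
      induction i with
      | zero => intro e he _; exact he
      | succ i ih =>
        intro e he hcyc
        rw [Function.iterate_succ_apply', peel, List.mem_filter]
        refine ⟨ih e he hcyc, ?_⟩
        rw [decide_eq_true_eq]
        rcases Relation.ReflTransGen.cases_head hcyc with h | ⟨z, h1, h2⟩
        · exact ⟨e, ih e he hcyc, h.symm⟩
        · exact ⟨(e.2, z), ih _ h1 (h2.tail he), rfl⟩
    obtain ⟨y, h1, h2⟩ := Relation.TransGen.head'_iff.1 hx
    have := key s.length (x, y) h1 h2
    rw [← List.foldl_const] at this
    exact List.ne_nil_of_mem this hnil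
  · intro hne
    obtain ⟨e₀, he₀⟩ := List.exists_mem_of_ne_nil _ hne
    have hnext : ∀ e : {e // e ∈ peelAll s}, ∃ f : {e // e ∈ peelAll s}, f.1.1 = e.1.2 := by
      rintro ⟨e, he⟩
      rw [← peel_peelAll, peel, List.mem_filter, decide_eq_true_eq] at he
      obtain ⟨f, hf, hfe⟩ := he.2
      exact ⟨⟨f, hf⟩, hfe⟩
    choose g hg using hnext
    have hwalk : ∀ (e : {e // e ∈ peelAll s}) (i : ℕ),
        Relation.TransGen R e.1.1 (g^[i + 1] e).1.1 := by
      intro e i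
      induction i with
      | zero =>
        rw [Function.iterate_one, hg]
        exact .single (peelAll_subset s e.2)
      | succ i ih =>
        rw [Function.iterate_succ_apply', hg]
        exact ih.tail (peelAll_subset s (g^[i + 1] e).2)
    have : Finite {e // e ∈ peelAll s} := (peelAll s).finite_toSet
    obtain ⟨i, j, hij, heq⟩ := Finite.exists_ne_map_eq_of_infinite
      (fun i : ℕ => g^[i] ⟨e₀, he₀⟩)
    wlog hlt : i < j generalizing i j
    · exact this j i hij.symm heq.symm (by omega)
    refine ⟨(g^[i] ⟨e₀, he₀⟩).1.1, ?_⟩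
    have h1 := hwalk (g^[i] ⟨e₀, he₀⟩) (j - i - 1)
    rw [← Function.iterate_add_apply, show j - i - 1 + 1 + i = j by omega] at h1
    rw [← heq] at h1
    exact h1

/-! ### The algorithm on lists of edges -/

/-- All directed edges between the simplices in `L` and their facets. Edge sets are represented by
lists that are obtained by filtering this one. -/
def allEdges (L : List (Finset V)) : List (Edge V) :=
  (L.product L).filter (fun e => IsFacet e.1 e.2 ∨ IsFacet e.2 e.1)

/-- The Hasse graph oriented by `M`. -/
def orientedList (E M : List (Edge V)) : List (Edge V) :=
  E.filter (fun e => (IsFacet e.1 e.2 ∧ e ∈ M) ∨ (IsFacet e.2 e.1 ∧ ¬ (e.2, e.1) ∈ M))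

/-- The union of `C` and of the facet-edges of `β` in `H`. -/
def addFacetEdges (E C H : List (Edge V)) (β : Finset V) : List (Edge V) :=
  E.filter (fun e => e ∈ C ∨ (e ∈ H ∧ ((e.1 = β ∧ IsFacet e.2 β) ∨ (e.2 = β ∧ IsFacet e.1 β))))

/-- The graph `H` with the edge `χ` reversed. -/
def reverseList (E H : List (Edge V)) (χ : Edge V) : List (Edge V) :=
  E.filter (fun e => e = (χ.2, χ.1) ∨ (e ∈ H ∧ ¬ e = χ))

/-- The leading up-edges of `χ₀` in `H` that are not in `C`. -/
def leadingList (E C H : List (Edge V)) (χ₀ : Edge V) : List (Edge V) :=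
  E.filter (fun χ => (((χ₀ ∈ H ∧ IsFacet χ₀.1 χ₀.2) ∧
    ((χ₀.2, χ.1) ∈ H ∧ IsFacet χ.1 χ₀.2) ∧ χ ∈ H ∧ IsFacet χ.1 χ.2)) ∧ ¬ χ ∈ C)

/-- The edges of `H` that are not in `C`. -/
def diffList (H C : List (Edge V)) : List (Edge V) := H.filter (fun e => ¬ e ∈ C)

/-- The union of `G` and `C`. -/
def unionList (E G C : List (Edge V)) : List (Edge V) := E.filter (fun e => e ∈ G ∨ e ∈ C)

/-- The up-edges of `H`. -/
def upList (H : List (Edge V)) : List (Edge V) := H.filter (fun e => IsFacet e.1 e.2)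

/-- Examine the up-edge `χ`; the edges in `L'` are left in the inner loop. -/
def examine (E : List (Edge V)) (c : Config V) (χ : Edge V) (L' : List (Edge V)) : Config V :=
  if peelAll (addFacetEdges E c.2.2.1 c.1 χ.2) = [] then
    (c.1, c.2.1, addFacetEdges E c.2.2.1 c.1 χ.2, c.2.2.2.1 ++ [χ], L')
  else
    (reverseList E c.1 χ, c.2.1, addFacetEdges E c.2.2.1 (reverseList E c.1 χ) χ.2, c.2.2.2.1, L')

/-- Dequeue `χ₀`, leaving the queue `Q'`. -/
def dequeueNext (E : List (Edge V)) (c : Config V) (χ₀ : Edge V) (Q' : List (Edge V)) : Config V :=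
  (c.1, c.2.1, addFacetEdges E c.2.2.1 c.1 χ₀.2, Q',
    leadingList E (addFacetEdges E c.2.2.1 c.1 χ₀.2) c.1 χ₀)

/-- Return the component and start a new one, if an up-edge is left. -/
def nextComponent (E : List (Edge V)) (c : Config V) : Config V :=
  listCase (upList (diffList c.1 c.2.2.1)) c
    (fun χ _ => (diffList c.1 c.2.2.1, unionList E c.2.1 c.2.2.1, [], [χ], []))

/-- Process the next edge of the list, if there is one, or else of the queue, if there is one. -/
def next (E : List (Edge V)) (c : Config V) : Config V :=
  listCase c.2.2.2.2
    (listCase c.2.2.2.1 (nextComponent E c) (fun χ₀ Q' => dequeueNext E c χ₀ Q'))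
    (fun χ L' => examine E c χ L')

/-- A list that is longer than any run of the algorithm. -/
def runRounds {γ : Type} (L : List γ) : List Unit :=
  () :: () :: (L.map (fun _ => ()) ++ L.map (fun _ => ()))

/-- An output of the algorithm on the complex with the faces `L`. -/
def frontierEdges (L : List (Finset V)) : List (Edge V) :=
  let E := allEdges L
  let c := (runRounds L).foldl (fun c _ => next E c)
    (orientedList E (maximumMatching L), [], [], [], [])
  unionList E (unionList E c.2.1 c.2.2.1) (diffList c.1 c.2.2.1)

variable {E H G C Q L : List (Edge V)} {χ : Edge V} {β : Finset V}

theorem addFacetEdges_eq (hH : H ⊆ E) (hC : C ⊆ E) :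
    {e | e ∈ addFacetEdges E C H β} = {e | e ∈ C} ∪ facetEdges {e | e ∈ H} β := by
  ext e
  have h1 := @hH e
  have h2 := @hC e
  simp only [addFacetEdges, facetEdges, Set.mem_ofPred_eq, List.mem_filter, decide_eq_true_eq,
    Set.mem_union]
  tauto

theorem reverseList_eq (hE : ∀ e ∈ E, (e.2, e.1) ∈ E) (hH : H ⊆ E) (hχ : χ ∈ E) :
    {e | e ∈ reverseList E H χ} = reverseEdge {e | e ∈ H} χ := by
  ext e
  have h1 := @hH e
  have h2 : e = χ.swap → e ∈ E := fun h => h ▸ hE χ hχ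
  simp only [reverseList, reverseEdge, Set.mem_ofPred_eq, List.mem_filter, decide_eq_true_eq,
    Set.mem_insert_iff, Set.mem_sdiff, Set.mem_singleton_iff, Prod.swap] at h2 ⊢
  tauto

theorem unionList_eq (hG : G ⊆ E) (hC : C ⊆ E) :
    {e | e ∈ unionList E G C} = {e | e ∈ G} ∪ {e | e ∈ C} := by
  ext e
  have h1 := @hG e
  have h2 := @hC e
  simp only [unionList, Set.mem_ofPred_eq, List.mem_filter, decide_eq_true_eq, Set.mem_union]
  tauto

theorem diffList_eq : {e | e ∈ diffList H C} = {e | e ∈ H} \ {e | e ∈ C} := by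
  ext e
  simp [diffList]

theorem upEdges_eq (H : List (Edge V)) : upEdges {e | e ∈ H} = {e | e ∈ upList H} := by
  ext e
  simp [upEdges, upList]

theorem mem_leadingList (hH : H ⊆ E) {χ₀ : Edge V} :
    χ ∈ leadingList E C H χ₀ ↔
      IsLeadingUpEdge {e | e ∈ H} χ₀ χ ∧ χ ∉ {e | e ∈ C} := by
  have h1 := @hH χ
  simp only [leadingList, IsLeadingUpEdge, upEdges, Set.mem_ofPred_eq, List.mem_filter,
    decide_eq_true_eq]
  tauto

theorem hasCycle_addFacetEdges (hH : H ⊆ E) (hC : C ⊆ E) :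
    peelAll (addFacetEdges E C H β) = [] ↔
      ¬ HasCycle ({e | e ∈ C} ∪ facetEdges {e | e ∈ H} β) := by
  rw [← addFacetEdges_eq hH hC, hasCycle_iff_peelAll, not_not]

/-- All edges of a configuration that is reached by the list version are in `E`. -/
structure ConfigInv (E : List (Edge V)) (c : Config V) : Prop where
  graph : c.1 ⊆ E
  out : c.2.1 ⊆ E
  comp : c.2.2.1 ⊆ E
  list : c.2.2.2.2 ⊆ E

theorem ConfigInv.next {c : Config V} (h : ConfigInv E c) :
    ConfigInv E (next E c) := by
  obtain ⟨H, G, C, Q, L⟩ := c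
  obtain ⟨h1, h2, h3, h4⟩ := h
  cases L with
  | nil =>
    cases Q with
    | nil =>
      simp only [FrontierEdges.next, listCase_nil, nextComponent]
      cases upList (diffList H C) with
      | nil => exact ⟨h1, h2, h3, h4⟩
      | cons χ l =>
        exact ⟨List.Subset.trans (List.filter_subset_self ..) h1, List.filter_subset_self .., by simp, by simp⟩
    | cons χ₀ Q => exact ⟨h1, h2, List.filter_subset_self .., List.filter_subset_self ..⟩
  | cons χ L =>
    have h5 : L ⊆ E := List.Subset.trans (List.subset_cons_self χ L) h4
    simp only [FrontierEdges.next, listCase_cons, examine]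
    split
    · exact ⟨h1, h2, List.filter_subset_self .., h5⟩
    · exact ⟨List.filter_subset_self .., h2, List.filter_subset_self .., h5⟩

/-- The lists are exhausted. -/
def IsFinal (c : Config V) : Prop :=
  c.2.2.2.1 = [] ∧ c.2.2.2.2 = [] ∧ upList (diffList c.1 c.2.2.1) = []

theorem next_eq_of_isFinal {c : Config V} (h : IsFinal c) : next E c = c := by
  obtain ⟨h1, h2, h3⟩ := h
  rw [next, h1, h2, listCase_nil, listCase_nil, nextComponent, h3, listCase_nil]

theorem run_next (hE : ∀ e ∈ E, (e.2, e.1) ∈ E) (hnd : E.Nodup) {c : Config V}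
    (h : ConfigInv E c) (hc : ¬ IsFinal c) {k : ℕ} {s : State V} (hk : Run k s (resume c)) :
    ∃ k' > k, Run k' s (resume (next E c)) := by
  obtain ⟨H, G, C, Q, L⟩ := c
  obtain ⟨h1, h2, h3, h4⟩ := h
  dsimp only at h1 h2 h3 h4
  cases L with
  | nil =>
    cases Q with
    | nil =>
      simp only [next, listCase_nil, nextComponent]
      cases hup : upList (diffList H C) with
      | nil => exact absurd ⟨rfl, rfl, hup⟩ hc
      | cons χ l =>
        refine ⟨k + 1, Nat.lt_succ_self k, ?_⟩
        have hχ : χ ∈ upEdges ({e | e ∈ H} \ {e | e ∈ C}) := by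
          rw [← diffList_eq, upEdges_eq, hup]
          simp
        have := hk.tail (.call _ _ χ hχ)
        simp only [listCase_cons, resume, diffList_eq, unionList_eq h2 h3]
        simpa using this
    | cons χ₀ Q =>
      have h5 : Run (k + 1) s _ := hk.tail (.dequeue _ _ _ {e | e ∈ addFacetEdges E C H χ₀.2} χ₀ Q
        (leadingList E (addFacetEdges E C H χ₀.2) H χ₀) (addFacetEdges_eq h1 h3) (hnd.filter _)
        fun χ => mem_leadingList h1)
      obtain ⟨k', h6, h7⟩ := run_resume_of_scan h5
      exact ⟨k', h6, h7⟩
  | cons χ L =>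
    have hχ : χ ∈ E := h4 (by simp)
    replace hk : Run k s (.scan {e | e ∈ H} {e | e ∈ G} {e | e ∈ C} Q (χ :: L)) := by
      cases Q <;> exact hk
    simp only [next, listCase_cons, examine]
    split
    next hcyc =>
      have h5 := hk.tail (.forward _ _ _ χ Q L ((hasCycle_addFacetEdges h1 h3).1 hcyc))
      rw [← addFacetEdges_eq h1 h3] at h5
      obtain ⟨k', h6, h7⟩ := run_resume_of_scan h5
      exact ⟨k', h6, h7⟩
    next hcyc =>
      have hcyc' := not_not.1 (fun h => hcyc ((hasCycle_addFacetEdges h1 h3).2 h))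
      have h5 := hk.tail (.backward _ _ _ _ χ Q L hcyc' (reverseList_eq hE h1 hχ))
      have h8 : reverseList E H χ ⊆ E := List.filter_subset_self ..
      rw [← addFacetEdges_eq h8 h3] at h5
      obtain ⟨k', h6, h7⟩ := run_resume_of_scan h5
      exact ⟨k', h6, h7⟩

/-- The list version makes at least one step of the algorithm in each round, until nothing is left to
do; so it is done after more rounds than the algorithm has steps. -/
theorem isOutput_frontierEdges {K : PreAbstractSimplicialComplex V} {L : List (Finset V)}
    (hnd : L.Nodup) (hL : ∀ σ, σ ∈ K.faces ↔ σ ∈ L) :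
    IsOutput K {e | e ∈ frontierEdges L} := by
  have hM := isMaximumMatching_maximumMatching hL
  have hK : K.faces.Finite := (List.finite_toSet L).subset fun σ hσ => (hL σ).1 hσ
  have hKn : K.faces.ncard = L.length := by
    rw [← List.toFinset_card_of_nodup hnd, ← Set.ncard_coe_finset]
    congr 1
    ext σ
    simp [hL]
  have hmem : ∀ e, e ∈ allEdges L ↔ e.1 ∈ K.faces ∧ e.2 ∈ K.faces ∧
      (IsFacet e.1 e.2 ∨ IsFacet e.2 e.1) := by
    intro e
    rw [allEdges, List.mem_filter, hL, hL, List.pair_mem_product (xs := L) (ys := L)]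
    simp [and_assoc]
  set E := allEdges L
  set M := maximumMatching L
  have hE : ∀ e ∈ E, (e.2, e.1) ∈ E := by
    intro e he
    have := (hmem e).1 he
    exact (hmem _).2 ⟨this.2.1, this.1, this.2.2.symm⟩
  have hEnd : E.Nodup := (hnd.product hnd).filter _
  set c₀ : Config V := (orientedList E M, [], [], [], []) with hc₀
  have hinit : resume c₀ = initial K {e | e ∈ M} := by
    have : {e | e ∈ orientedList E M} = orientedHasse K {e | e ∈ M} := by
      ext e
      have := hmem e
      simp only [orientedList, orientedHasse, Set.mem_ofPred_eq, List.mem_filter,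
        decide_eq_true_eq, Prod.swap]
      tauto
    simp [hc₀, resume, initial, this]
  have key : ∀ i, ConfigInv E ((next E)^[i] c₀) ∧
      ∃ k, Run k (initial K {e | e ∈ M}) (resume ((next E)^[i] c₀)) ∧
        (IsFinal ((next E)^[i] c₀) ∨ i ≤ k) := by
    intro i
    induction i with
    | zero =>
      exact ⟨⟨List.filter_subset_self .., by simp [hc₀], by simp [hc₀], by simp [hc₀]⟩, 0,
        hinit ▸ .refl _, .inr le_rfl⟩
    | succ i ih =>
      rw [Function.iterate_succ_apply']
      obtain ⟨h1, k, h2, h3⟩ := ih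
      refine ⟨h1.next, ?_⟩
      by_cases h6 : IsFinal ((next E)^[i] c₀)
      · rw [next_eq_of_isFinal h6]
        exact ⟨k, h2, .inl h6⟩
      · obtain ⟨k', h4, h5⟩ := run_next hE hEnd h1 h6 h2
        have := h3.resolve_left h6
        exact ⟨k', h5, .inr (by omega)⟩
  obtain ⟨h1, k, h2, h3⟩ := key (runRounds L).length
  rw [← List.foldl_const] at h1 h2 h3
  set c := (runRounds L).foldl (fun c _ => next E c) c₀ with hc
  have hlen : (runRounds L).length = 2 * K.faces.ncard + 2 := by
    rw [hKn]
    simp [runRounds]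
    omega
  have hk := (run_le_and_progress hK hM.1 h2).1
  have hfin := h3.resolve_right (by omega)
  have hout : frontierEdges L =
    unionList E (unionList E c.2.1 c.2.2.1) (diffList c.1 c.2.2.1) := rfl
  obtain ⟨H, G, C, Q, L'⟩ := c
  obtain ⟨h5, h6, h7⟩ := hfin
  dsimp only at h5 h6 h7 hout
  subst h5 h6
  refine ⟨{e | e ∈ M}, k + 1, hM, ?_⟩
  have h8 := h2.tail (.halt _ _ (by rw [← diffList_eq, upEdges_eq, h7]; simp))
  have h9 : unionList E G C ⊆ E := List.filter_subset_self ..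
  have h10 : diffList H C ⊆ E := List.Subset.trans (List.filter_subset_self ..) h1.graph
  rw [hout, unionList_eq h9 h10,
    unionList_eq h1.out h1.comp, diffList_eq]
  exact h8

end

section
variable {α : Type} [Data α]
open Polynomial Data

/-! ### The algorithm runs in polynomial time -/

@[fun_prop] theorem PolyTime.peel {f : α → List (Edge ℕ)} (hf : PolyTime f) :
    PolyTime (fun x => peel (f x)) := by
  unfold FrontierEdges.peel
  fun_prop

@[fun_prop] theorem PolyTime.peelAll {f : α → List (Edge ℕ)} (hf : PolyTime f) :
    PolyTime (fun x => peelAll (f x)) := by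
  unfold FrontierEdges.peelAll
  refine .foldl_of_size_le (c := fun _ => ()) (f := fun _ t _ => FrontierEdges.peel t)
    (by fun_prop) 0 (fun _ t _ => ?_) .unit hf hf
  have : size (FrontierEdges.peel t) ≤ size t := size_filter_le t _
  omega

variable {e h g c : α → List (Edge ℕ)} {χ : α → Edge ℕ} {β : α → Finset ℕ}

@[fun_prop] theorem PolyTime.orientedList (he : PolyTime e) (hg : PolyTime g) :
    PolyTime (fun x => orientedList (e x) (g x)) := by
  unfold FrontierEdges.orientedList
  fun_prop

@[fun_prop] theorem PolyTime.addFacetEdges (he : PolyTime e) (hc : PolyTime c) (hh : PolyTime h)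
    (hβ : PolyTime β) : PolyTime (fun x => addFacetEdges (e x) (c x) (h x) (β x)) := by
  unfold FrontierEdges.addFacetEdges
  fun_prop

@[fun_prop] theorem PolyTime.reverseList (he : PolyTime e) (hh : PolyTime h) (hχ : PolyTime χ) :
    PolyTime (fun x => reverseList (e x) (h x) (χ x)) := by
  unfold FrontierEdges.reverseList
  fun_prop

@[fun_prop] theorem PolyTime.leadingList (he : PolyTime e) (hc : PolyTime c) (hh : PolyTime h)
    (hχ : PolyTime χ) : PolyTime (fun x => leadingList (e x) (c x) (h x) (χ x)) := by
  unfold FrontierEdges.leadingList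
  fun_prop

@[fun_prop] theorem PolyTime.diffList (hh : PolyTime h) (hc : PolyTime c) :
    PolyTime (fun x => diffList (h x) (c x)) := by
  unfold FrontierEdges.diffList
  fun_prop

@[fun_prop] theorem PolyTime.unionList (he : PolyTime e) (hg : PolyTime g) (hc : PolyTime c) :
    PolyTime (fun x => unionList (e x) (g x) (c x)) := by
  unfold FrontierEdges.unionList
  fun_prop

@[fun_prop] theorem PolyTime.upList (hh : PolyTime h) : PolyTime (fun x => upList (h x)) := by
  unfold FrontierEdges.upList
  fun_prop

variable {s : α → Config ℕ}

@[fun_prop] theorem PolyTime.examine (he : PolyTime e) (hs : PolyTime s) (hχ : PolyTime χ)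
    (hh : PolyTime h) : PolyTime (fun x => examine (e x) (s x) (χ x) (h x)) := by
  unfold FrontierEdges.examine
  fun_prop

@[fun_prop] theorem PolyTime.dequeueNext (he : PolyTime e) (hs : PolyTime s) (hχ : PolyTime χ)
    (hh : PolyTime h) : PolyTime (fun x => dequeueNext (e x) (s x) (χ x) (h x)) := by
  unfold FrontierEdges.dequeueNext
  fun_prop

@[fun_prop] theorem PolyTime.nextComponent (he : PolyTime e) (hs : PolyTime s) :
    PolyTime (fun x => nextComponent (e x) (s x)) := by
  unfold FrontierEdges.nextComponent
  fun_prop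

@[fun_prop] theorem PolyTime.next (he : PolyTime e) (hs : PolyTime s) :
    PolyTime (fun x => next (e x) (s x)) := by
  unfold FrontierEdges.next
  fun_prop

theorem size_tail_le {γ : Type} [Data γ] (x : γ) (l : List γ) : size l ≤ size (x :: l) :=
  size_le_of_subset (by simp) (by simp)

theorem size_append_singleton {γ : Type} [Data γ] (l : List γ) (x : γ) :
    size (l ++ [x]) ≤ max (size x) (size l + 1) := by
  have := length_le_size l
  refine size_list_le.2 ⟨by simp; omega, fun y hy => ?_⟩
  rcases List.mem_append.1 hy with hy | hy
  · have := size_le_of_mem hy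
    omega
  · rw [List.mem_singleton.1 hy]
    omega

/-- The sets are cut out of `E`, and the queue grows by at most one edge. -/
theorem size_next_le (E : List (Edge ℕ)) (c : Config ℕ) :
    size (next E c) ≤ max (size E) (size c + 1) := by
  obtain ⟨H, G, C, Q, L⟩ := c
  cases L with
  | nil =>
    cases Q with
    | nil =>
      simp only [next, listCase_nil, nextComponent]
      cases hup : upList (diffList H C) with
      | nil => exact le_max_of_le_right (Nat.le_succ _)
      | cons χ l =>
        have h1 : χ ∈ H := by
          have : χ ∈ upList (diffList H C) := by simp [hup]
          exact List.mem_of_mem_filter (List.mem_of_mem_filter this)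
        have h2 := size_le_of_mem h1
        have h3 := size_cons χ []
        have h4 : size (diffList H C) ≤ size H := size_filter_le ..
        have h5 : size (unionList E G C) ≤ size E := size_filter_le ..
        have h6 : size ([] : List (Edge ℕ)) = 0 := rfl
        simp only [listCase_cons, size_prod] at *
        omega
    | cons χ₀ Q =>
      have h1 := size_tail_le χ₀ Q
      have h2 : ∀ β, size (addFacetEdges E C H β) ≤ size E := fun _ => size_filter_le ..
      have h3 : ∀ C', size (leadingList E C' H χ₀) ≤ size E := fun _ => size_filter_le ..
      have h4 := h2 χ₀.2
      have h5 := h3 (addFacetEdges E C H χ₀.2)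
      simp only [next, listCase_nil, listCase_cons, dequeueNext, size_prod] at *
      omega
  | cons χ L =>
    have h1 := size_tail_le χ L
    have h2 : ∀ H, size (addFacetEdges E C H χ.2) ≤ size E := fun _ => size_filter_le ..
    have h3 : size (reverseList E H χ) ≤ size E := size_filter_le ..
    have h4 := size_append_singleton Q χ
    have h5 : size χ ≤ size (χ :: L) := size_le_of_mem (by simp)
    have h6 := h2 H
    have h7 := h2 (reverseList E H χ)
    simp only [next, listCase_cons, examine]
    split <;> simp only [size_prod] at * <;> omega

theorem polyTime_frontierEdges : PolyTime (frontierEdges : List (Finset ℕ) → List (Edge ℕ)) := by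
  have hE : PolyTime (fun L : List (Finset ℕ) => allEdges L) := by
    unfold allEdges
    fun_prop
  have hR : PolyTime (fun L : List (Finset ℕ) => runRounds L) := by
    unfold runRounds
    fun_prop
  have hc : PolyTime (fun L : List (Finset ℕ) =>
      (runRounds L).foldl (fun c _ => next (allEdges L) c)
        (orientedList (allEdges L) (maximumMatching L), [], [], [], [])) := by
    refine .foldl_of_size_le (f := fun E c _ => next E c) (by fun_prop) X (fun E c _ => ?_) hE
      (by fun_prop) hR
    have := size_next_le E c
    simp only [eval_X]
    omega
  show PolyTime (fun L => unionList (allEdges L) _ _)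
  fun_prop

/-! ### Complexes given as lists -/

theorem Lists.mem_faces_iff {K : PreAbstractSimplicialComplex ℕ} {L : List (List ℕ)}
    (h : Lists L K) (σ : Finset ℕ) : σ ∈ K.faces ↔ σ ∈ L.map List.toFinset := by
  rw [h.2.2, List.mem_map]

theorem Lists.rep {K : PreAbstractSimplicialComplex ℕ} {L : List (List ℕ)}
    (h : Lists L K) : Rep (α := List (Finset ℕ)) L (L.map List.toFinset) := by
  have h1 := h.1
  clear h
  induction L with
  | nil => exact .nil
  | cons l L ih =>
    exact .cons (rep_toFinset (h1 l (by simp))) (ih fun l' hl' => h1 l' (by simp [hl']))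

/-- A simplex has at least as many faces as vertices. -/
theorem card_le_ncard_faces {V : Type*} {K : PreAbstractSimplicialComplex V}
    (hK : K.faces.Finite) {σ : Finset V} (hσ : σ ∈ K.faces) : σ.card ≤ K.faces.ncard := by
  rw [← Set.ncard_coe_finset]
  refine Set.ncard_le_ncard_of_injOn (fun v => {v}) (fun v hv => ?_)
    (fun v _ w _ h => Finset.singleton_injective h) hK
  exact K.isRelLowerSet_faces.mem_of_le hσ (Finset.singleton_subset_iff.2 hv) (by simp)

theorem Lists.size_le {K : PreAbstractSimplicialComplex ℕ} {L : List (List ℕ)}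
    (h : Lists L K) : size (L.map List.toFinset) ≤ K.faces.ncard := by
  have hK : K.faces.Finite := (List.finite_toSet (L.map List.toFinset)).subset
    fun σ hσ => (h.mem_faces_iff σ).1 hσ
  refine size_list_le.2 ⟨?_, fun σ hσ => card_le_ncard_faces hK ((h.mem_faces_iff σ).2 hσ)⟩
  rw [← List.toFinset_card_of_nodup h.2.1, ← Set.ncard_coe_finset]
  refine (congrArg Set.ncard ?_).le
  ext σ
  simp [h.mem_faces_iff]

theorem edgesOf_eq {E : List (List ℕ × List ℕ)} {E' : List (Edge ℕ)}
    (h : Rep (α := List (Edge ℕ)) E E') : edgesOf E = {e | e ∈ E'} := by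
  replace h : List.Forall₂ (fun (p : List ℕ × List ℕ) (e : Edge ℕ) =>
    (p.1.Nodup ∧ p.1.toFinset = e.1) ∧ (p.2.Nodup ∧ p.2.toFinset = e.2)) E E' := h
  ext e
  simp only [edgesOf, Set.mem_ofPred_eq]
  induction h with
  | nil => simp
  | cons h1 _ ih =>
    rw [List.mem_cons, ← ih, List.exists_mem_cons_iff, h1.1.2, h1.2.2]

end

end FrontierEdges

theorem mainTheorem4 :
    -- every execution, whatever choices are made, terminates after linearly many steps, and
    -- returns the Hasse graph oriented by a Morse matching with the claimed approximation factor
    (∀ (V : Type*) (K : PreAbstractSimplicialComplex V), K.faces.Finite →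
      ∀ M : Set (Edge V), IsMaximumMatching K M →
        (∀ (k : ℕ) (s : State V), Run k (initial K M) s →
          k ≤ 2 * K.faces.ncard + 1 ∧ ((∃ G, s = .halted G) ∨ ∃ t, Step s t)) ∧
        (∀ (k : ℕ) (G : Set (Edge V)), Run k (initial K M) (.halted G) →
          G = orientedHasse K (upEdges G) ∧
          IsApproxMaxMorseMatching K
            (((dimension K : ℚ) + 1) / ((dimension K : ℚ) ^ 2 + (dimension K : ℚ) + 1))
            (upEdges G))) ∧
    -- the algorithm can be carried out in time polynomial in the number of simplices
    (∃ (P : Prog (.list simplexTy) (.list (.prod simplexTy simplexTy))) (p : Polynomial ℕ),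
      ∀ (K : PreAbstractSimplicialComplex ℕ) (L : List (List ℕ)), Lists L K →
        (P.exec L).2 ≤ p.eval K.faces.ncard ∧ IsOutput K (edgesOf (P.exec L).1)) := by
  refine ⟨fun V K hK M hM => ⟨fun k s h => run_le_and_progress hK hM.1 h,
    fun k G h => approx_of_run hK hM h⟩, ?_⟩
  obtain ⟨P, p, h⟩ := polyTime_frontierEdges
  refine ⟨P, p, fun K L hL => ?_⟩
  obtain ⟨h1, h2⟩ := h L (L.map List.toFinset) hL.rep
  refine ⟨h2.trans (eval_le_eval p hL.size_le), ?_⟩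
  rw [edgesOf_eq h1]
  exact isOutput_frontierEdges hL.2.1 hL.mem_faces_iff
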